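/- Let $\gamma$ be the standard Gaussian probability measure on $\mathbb{R}^n$. For a probability measure $d\nu = f\,d\gamma$ on $\mathbb{R}^n$ with density $f\ge 0$, let $$H(\nu)=\int_{\mathbb{R}^n} f\log f\,d\gamma,\qquad I(\nu)=\int_{\mathbb{R}^n}\frac{|\nabla f|^2}{f}\,d\gamma,\qquad \delta_{\mathrm{LSI}}(\nu)=\tfrac12 I(\nu)-H(\nu)$$ be its relative entropy, its Fisher information (with $\nabla f$ the weak gradient, $0/0=0$, and $I(\nu)=\infty$ if $f$ has no locally integrable weak gradient) and its logarithmic Sobolev deficit. For $\lambda>0$ let $\mathcal{P}(\lambda)$ be the class of probability measures $\nu$ on $\mathbb{R}^n$ such that $\lambda\int g^2\,d\nu\le\int|\nabla g|^2\,d\nu$ for every smooth $\nu$-integrable $g:\mathbb{R}^n\to\mathbb{R}$ with $\int g\,d\nu=0$. Put $$c(\lambda)=\frac{1-\lambda+\lambda\log\lambda}{(1-\lambda)^2}\quad(\lambda\neq 1),\qquad c(1)=\tfrac12,\qquad c_1(\lambda)=\tfrac12\,(1-c(\lambda)).$$ Theorem. Let $\lambda>0$. Then $c(\lambda)<1$.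 For every centered ($\int x\,d\nu=0$) probability measure $d\nu=f\,d\gamma$ in $\mathcal{P}(\lambda)$ with $I(\nu)<\infty$, the entropy $H(\nu)$ is finite and $$H(\nu)\le\frac{c(\lambda)}{2}\,I(\nu),\qquad\text{equivalently}\qquad \delta_{\mathrm{LSI}}(\nu)\ge c_1(\lambda)\,I(\nu).$$ The constant is sharp: if $n\ge1$ and $C\in\mathbb{R}$ is such that $H(\nu)\le\frac{C}{2}I(\nu)$ for all centered $d\nu=f\,d\gamma$ in $\mathcal{P}(\lambda)$ on $\mathbb{R}^n$ with $I(\nu)<\infty$, then $C\ge c(\lambda)$. Moreover, on the line ($n=1$), the measure with density $f(x)=\sqrt{\lambda}\,e^{(1-\lambda)x^2/2}$ with respect to $\gamma$ is centered, belongs to $\mathcal{P}(\lambda)$, has finite Fisher information, and satisfies $H(\nu)=\frac{c(\lambda)}{2}I(\nu)$. -/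

import Mathlib

open MeasureTheory ProbabilityTheory
open scoped ENNReal ContDiff

namespace GaussLSI

/-- Euclidean space `ℝⁿ`. -/
abbrev E (n : ℕ) : Type := EuclideanSpace ℝ (Fin n)

/-- The standard Gaussian probability measure `γ` on `ℝⁿ`. -/
noncomputable def γ (n : ℕ) : Measure (E n) := stdGaussian (E n)

/-- The measure `dν = f dγ` with density `f` with respect to `γ`. -/
noncomputable def withGaussDensity {n : ℕ} (f : E n → ℝ) : Measure (E n) :=
  (γ n).withDensity (fun x => ENNReal.ofReal (f x))

/-- `G` is the weak (distributional) gradient of `f` on `ℝⁿ`: both are locally integrable and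
`∫ f ∇φ dx = - ∫ φ G dx` for every smooth compactly supported `φ`. -/
structure IsWeakGradient {n : ℕ} (f : E n → ℝ) (G : E n → E n) : Prop where
  locallyIntegrable : LocallyIntegrable f volume
  locallyIntegrable_grad : LocallyIntegrable G volume
  integral_eq : ∀ φ : E n → ℝ, ContDiff ℝ ∞ φ → HasCompactSupport φ →
    ∫ x, f x • gradient φ x = - ∫ x, φ x • G x

/-- The Fisher information `I(ν) = ∫ |∇f|² / f dγ` of `dν = f dγ`, with the gradient taken in the
weak sense, as an element of `[0, ∞]`. A weak gradient is unique up to a null set, so the infimum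
only means that the value is `∞` if `f` has no weak gradient. Here `0 / 0 = 0`, which matters
only on the set `{f = 0}`. -/
noncomputable def fisherInfo {n : ℕ} (f : E n → ℝ) : ℝ≥0∞ :=
  ⨅ (G : E n → E n) (_ : IsWeakGradient f G),
    ∫⁻ x, ‖G x‖ₑ ^ 2 / ENNReal.ofReal (f x) ∂(γ n)

/-- The relative entropy `H(ν) = ∫ f log f dγ` of `dν = f dγ`
(meaningful when the integrand is integrable). -/
noncomputable def entropy {n : ℕ} (f : E n → ℝ) : ℝ :=
  ∫ x, f x * Real.log (f x) ∂(γ n)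

/-- The logarithmic Sobolev deficit `δ(ν) = I(ν) / 2 - H(ν)`
(meaningful when both terms are finite). -/
noncomputable def deficit {n : ℕ} (f : E n → ℝ) : ℝ :=
  (1 / 2) * (fisherInfo f).toReal - entropy f

/-- `ν` satisfies a Poincaré inequality with constant `lam`: for every smooth `g` with
`∫ g dν = 0`, `lam ∫ g² dν ≤ ∫ |∇g|² dν` (as an inequality in `[0, ∞]`). -/
def Poincare {n : ℕ} (lam : ℝ) (ν : Measure (E n)) : Prop :=
  ∀ g : E n → ℝ, ContDiff ℝ ∞ g → Integrable g ν → ∫ x, g x ∂ν = 0 →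
    ENNReal.ofReal lam * ∫⁻ x, ‖g x‖ₑ ^ 2 ∂ν ≤ ∫⁻ x, ‖gradient g x‖ₑ ^ 2 ∂ν

/-- `ν` is centered: it has a first moment and `∫ x dν = 0`. -/
def Centered {n : ℕ} (ν : Measure (E n)) : Prop :=
  Integrable (fun x : E n => x) ν ∧ ∫ x, x ∂ν = 0

/-- `f` is the density with respect to `γ` of a centered probability measure on `ℝⁿ` that
satisfies a Poincaré inequality with constant `lam`. -/
structure IsCenteredPoincareDensity (n : ℕ) (lam : ℝ) (f : E n → ℝ) : Prop where
  measurable : Measurable f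
  nonneg : ∀ x, 0 ≤ f x
  isProbabilityMeasure : IsProbabilityMeasure (withGaussDensity f)
  centered : Centered (withGaussDensity f)
  poincare : Poincare lam (withGaussDensity f)

/-- `c(λ) = (1 - λ + λ log λ) / (1 - λ)²`, with `c(1) = 1/2`. -/
noncomputable def c (lam : ℝ) : ℝ :=
  if lam = 1 then 1 / 2 else (1 - lam + lam * Real.log lam) / (1 - lam) ^ 2

/-- `c₁(λ) = (1 - c(λ)) / 2`. -/
noncomputable def c₁ (lam : ℝ) : ℝ := (1 - c lam) / 2

/-- The density `√λ exp((1 - λ) x² / 2)` on the line. -/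
noncomputable def lineGaussDensity (lam : ℝ) (x : E 1) : ℝ :=
  Real.sqrt lam * Real.exp ((1 - lam) * (x 0) ^ 2 / 2)

end GaussLSI

namespace GaussLSI

/-! ### Smooth functions with bounded derivatives -/

/-! The inequality is proved in dual form: for bounded measurable `h` bounded away from zero, `∫ log
h dν ≤ log ∫ h dγ + (c(λ)/2) I(ν)`. Testing with truncations of `f` then gives integrability of `f
log f` and the entropy bound (`entropy_le_of_dual`).

For smooth `h`, write `P_θ` for `mehler θ` and let both `h` and `ν` evolve: `F(θ) = ∫ P_θ(log P_θ h)
dν`. It runs from `∫ log h dν` at `θ = 0` to `log ∫ h dγ` at `θ = π/2`; the angle makes infinite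
time a regular endpoint. Put `ψ = log P_θ h`, `w_i = ∂_i ψ`, and let `G` be the weak gradient of
`f`. Differentiating and integrating by parts (`hasDerivAt_interpolation`, `integral_rotDeriv`), all
second derivatives of `ψ` cancel and `F'(θ) = (sin θ / cos θ) Σ_i (∫ P_θ(w_i²) dν - 2 cos θ ∫ G_i
P_θ w_i dγ)`.

Both hypotheses on `ν` enter in the second term. Since `ν` is centered, `∫ G_i dγ = 0`, so `P_θ w_i`
may be replaced by its deviation from its `ν`-mean. The Poincaré inequality, combined with a reverse
Poincaré inequality for `P_θ` (`sum_sq_pd_mehler_le`), bounds the `ν`-variance of `P_θ w_i` by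
`cos²θ / (cos²θ + λ sin²θ)` times `∫ P_θ(w_i²) dν` (`Poincare.variance_mehler_le`). Young's
inequality then absorbs the first term exactly and leaves `F'(θ) ≥ - I(ν) sin θ cos³θ / (cos²θ + λ
sin²θ)`. With `u = cos²θ`, the integral of this weight over `[0, π/2]` is `½ ∫₀¹ u / (u + λ(1-u)) du
= c(λ)/2` (`exists_antiderivative`).

Sharpness and equality come from isotropic Gaussians with covariance `μ⁻¹` times the identity, whose
entropy is explicit. They satisfy the Poincaré inequality with constant `μ`, by scaling that of `γ`;
the latter follows from the same interpolation with `t²` in place of `log`. -/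

/-- The `i`-th partial derivative. -/
noncomputable def pd {n : ℕ} (i : Fin n) (u : E n → ℝ) (x : E n) : ℝ :=
  fderiv ℝ u x (EuclideanSpace.single i 1)

/-- Smooth functions all of whose derivatives, including the zeroth one, are bounded. -/
structure BddSmooth {n : ℕ} {F : Type*} [NormedAddCommGroup F] [NormedSpace ℝ F]
    (u : E n → F) : Prop where
  contDiff : ContDiff ℝ ∞ u
  bdd : ∀ k : ℕ, ∃ C : ℝ, ∀ x, ‖iteratedFDeriv ℝ k u x‖ ≤ C

instance (n : ℕ) : IsProbabilityMeasure (γ n) := by unfold γ; infer_instance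

instance (n : ℕ) : IsGaussian (γ n) := by unfold γ; infer_instance

namespace BddSmooth

variable {n : ℕ} {F : Type*} [NormedAddCommGroup F] [NormedSpace ℝ F]

lemma exists_norm_le {u : E n → F} (hu : BddSmooth u) : ∃ C : ℝ, 0 ≤ C ∧ ∀ x, ‖u x‖ ≤ C := by
  obtain ⟨C, hC⟩ := hu.bdd 0
  exact ⟨C, (norm_nonneg _).trans (hC 0), fun x => by simpa using hC x⟩

lemma continuous {u : E n → F} (hu : BddSmooth u) : Continuous u := hu.contDiff.continuous

lemma differentiable {u : E n → F} (hu : BddSmooth u) : Differentiable ℝ u :=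
  hu.contDiff.differentiable (by simp)

lemma fderiv {u : E n → F} (hu : BddSmooth u) : BddSmooth (fderiv ℝ u) where
  contDiff := hu.contDiff.fderiv_right (m := ∞) (by simp)
  bdd k := by
    obtain ⟨C, hC⟩ := hu.bdd (k + 1)
    exact ⟨C, fun x => by rw [norm_iteratedFDeriv_fderiv]; exact hC x⟩

lemma clm_comp {G : Type*} [NormedAddCommGroup G] [NormedSpace ℝ G] {u : E n → F}
    (hu : BddSmooth u) (L : F →L[ℝ] G) : BddSmooth (fun x => L (u x)) where
  contDiff := L.contDiff.comp hu.contDiff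
  bdd k := by
    obtain ⟨C, hC⟩ := hu.bdd k
    refine ⟨‖L‖ * C, fun x => ?_⟩
    have := L.norm_iteratedFDeriv_comp_left (f := u) (x := x) (n := k) (N := ∞)
      hu.contDiff.contDiffAt (by exact_mod_cast le_top)
    exact this.trans (mul_le_mul_of_nonneg_left (hC x) (norm_nonneg _))

lemma pd {u : E n → ℝ} (hu : BddSmooth u) (i : Fin n) : BddSmooth (pd i u) :=
  hu.fderiv.clm_comp (ContinuousLinearMap.apply ℝ ℝ (EuclideanSpace.single i 1))

lemma const (a : F) : BddSmooth (fun _ : E n => a) where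
  contDiff := contDiff_const
  bdd k := ⟨‖a‖, fun x => by
    rcases k with _ | k
    · simp
    · simp [iteratedFDeriv_const_of_ne]⟩

lemma add {u v : E n → F} (hu : BddSmooth u) (hv : BddSmooth v) :
    BddSmooth (fun x => u x + v x) where
  contDiff := hu.contDiff.add hv.contDiff
  bdd k := by
    obtain ⟨C, hC⟩ := hu.bdd k
    obtain ⟨D, hD⟩ := hv.bdd k
    refine ⟨C + D, fun x => ?_⟩
    have : iteratedFDeriv ℝ k (fun x => u x + v x) x
        = iteratedFDeriv ℝ k u x + iteratedFDeriv ℝ k v x :=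
      iteratedFDeriv_add_apply (hu.contDiff.contDiffAt.of_le (by exact_mod_cast le_top))
        (hv.contDiff.contDiffAt.of_le (by exact_mod_cast le_top))
    rw [this]
    exact (norm_add_le _ _).trans (add_le_add (hC x) (hD x))

lemma of_hasCompactSupport {u : E n → F} (hu : ContDiff ℝ ∞ u) (hc : HasCompactSupport u) :
    BddSmooth u where
  contDiff := hu
  bdd k := by
    have h1 : Continuous (iteratedFDeriv ℝ k u) :=
      hu.continuous_iteratedFDeriv (by exact_mod_cast le_top)
    exact h1.bounded_above_of_compact_support (hc.iteratedFDeriv k)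

/-- Composition with a function that is smooth near the (compact) range. -/
lemma comp {φ : ℝ → ℝ} {U : Set ℝ} {a b : ℝ} (hU : IsOpen U) (hφ : ContDiffOn ℝ ∞ φ U)
    (hab : Set.Icc a b ⊆ U) {u : E n → ℝ} (hu : BddSmooth u) (hr : ∀ x, u x ∈ Set.Icc a b) :
    BddSmooth (fun x => φ (u x)) where
  contDiff := hφ.comp_contDiff hu.contDiff fun x => hab (hr x)
  bdd k := by
    have hcont : ∀ i : ℕ, ∃ C, ∀ y ∈ Set.Icc a b, ‖iteratedFDerivWithin ℝ i φ U y‖ ≤ C := by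
      intro i
      have : ContinuousOn (iteratedFDerivWithin ℝ i φ U) (Set.Icc a b) :=
        (hφ.continuousOn_iteratedFDerivWithin (by exact_mod_cast le_top) hU.uniqueDiffOn).mono hab
      exact isCompact_Icc.exists_bound_of_continuousOn this
    choose C hC using hcont
    choose D hD using hu.bdd
    have hC0 : ∀ i, 0 ≤ C i := fun i => (norm_nonneg _).trans (hC i _ (hr 0))
    have hD0 : ∀ i, 0 ≤ D i := fun i => (norm_nonneg _).trans (hD i 0)
    set B := ∑ i ∈ Finset.range (k + 1), C i
    -- The Faà di Bruno estimate wants the `i`-th derivative of the inner function bounded by `A ^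
    -- i`; the summand `1` gives `A ≤ A ^ i` for `i ≥ 1`.
    set A := 1 + ∑ i ∈ Finset.range (k + 1), D i
    have hA : 1 ≤ A := by
      have : 0 ≤ ∑ i ∈ Finset.range (k + 1), D i := Finset.sum_nonneg fun i _ => hD0 i
      simp only [A]; linarith
    refine ⟨k.factorial * B * A ^ k, fun x => ?_⟩
    refine norm_iteratedFDeriv_comp_le' (N := ∞) (t := U) (g := φ) (f := u) ?_ hU.uniqueDiffOn
      hφ hu.contDiff (by exact_mod_cast le_top) x ?_ ?_
    · rintro _ ⟨y, rfl⟩; exact hab (hr y)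
    · intro i hi
      refine (hC i _ (hr x)).trans ?_
      exact Finset.single_le_sum (f := C) (fun j _ => hC0 j) (Finset.mem_range.2 (by omega))
    · intro i h1 hi
      have h2 : D i ≤ A := by
        have := Finset.single_le_sum (f := D) (fun j _ => hD0 j)
          (Finset.mem_range.2 (Nat.lt_succ_of_le hi))
        simp only [A]; linarith
      exact (hD i x).trans (h2.trans (le_self_pow₀ hA (by omega)))

lemma integrable {u : E n → F} (hu : BddSmooth u)
    (μ : Measure (E n)) [IsFiniteMeasure μ] : Integrable u μ := by
  obtain ⟨C, _, hC⟩ := hu.exists_norm_le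
  exact Integrable.of_bound hu.continuous.aestronglyMeasurable C (Filter.Eventually.of_forall hC)

end BddSmooth

/-! ### The Mehler operators -/

/-- The Ornstein-Uhlenbeck semigroup at time `-log cos θ`, in Mehler's form. -/
noncomputable def mehler {n : ℕ} {F : Type*} [NormedAddCommGroup F] [NormedSpace ℝ F]
    (θ : ℝ) (u : E n → F) (x : E n) : F :=
  ∫ z, u (Real.cos θ • x + Real.sin θ • z) ∂(γ n)

section mehler

variable {n : ℕ} {F : Type} [NormedAddCommGroup F] [NormedSpace ℝ F]

lemma BddSmooth.integrable_comp_affine {u : E n → F} (hu : BddSmooth u) (μ : Measure (E n))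
    [IsFiniteMeasure μ] (r s : ℝ) (x : E n) : Integrable (fun z => u (r • x + s • z)) μ := by
  obtain ⟨C, _, hC⟩ := hu.exists_norm_le
  exact Integrable.of_bound (hu.continuous.comp (by fun_prop)).aestronglyMeasurable C
    (Filter.Eventually.of_forall fun z => hC _)

lemma norm_mehler_le {u : E n → F} {C : ℝ} (hC : ∀ x, ‖u x‖ ≤ C) (θ : ℝ) (x : E n) :
    ‖mehler θ u x‖ ≤ C := by
  refine (norm_integral_le_of_norm_le_const (Filter.Eventually.of_forall fun z => hC _)).trans ?_
  simp

/-- The commutation `∇P_θ = cos θ P_θ ∇`, by differentiation under the integral with a constant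
dominating function. Vector-valued `u` is allowed so that the identity can be iterated. -/
lemma hasFDerivAt_mehler {u : E n → F} (hu : BddSmooth u) (θ : ℝ) (x : E n) :
    HasFDerivAt (mehler θ u) (Real.cos θ • mehler θ (fderiv ℝ u) x) x := by
  obtain ⟨C, hC0, hC⟩ := hu.fderiv.exists_norm_le
  have key := hasFDerivAt_integral_of_dominated_of_fderiv_le (𝕜 := ℝ) (μ := γ n)
    (F := fun x z => u (Real.cos θ • x + Real.sin θ • z))
    (F' := fun x z => Real.cos θ • fderiv ℝ u (Real.cos θ • x + Real.sin θ • z))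
    (bound := fun _ => |Real.cos θ| * C) (x₀ := x) (s := Set.univ) Filter.univ_mem
    (Filter.Eventually.of_forall fun y => (hu.integrable_comp_affine _ _ _ y).aestronglyMeasurable)
    (hu.integrable_comp_affine _ _ _ x)
    ((hu.fderiv.integrable_comp_affine _ _ _ x).smul (Real.cos θ)).aestronglyMeasurable
    (Filter.Eventually.of_forall fun z y _ => by
      rw [norm_smul, Real.norm_eq_abs]
      exact mul_le_mul_of_nonneg_left (hC _) (abs_nonneg _))
    (integrable_const _)
    (Filter.Eventually.of_forall fun z y _ => by
      have h1 : HasFDerivAt (fun y : E n => Real.cos θ • y + Real.sin θ • z)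
          (Real.cos θ • ContinuousLinearMap.id ℝ (E n)) y :=
        ((hasFDerivAt_id (𝕜 := ℝ) y).const_smul (Real.cos θ)).add_const (Real.sin θ • z)
      have h2 := ((hu.differentiable _).hasFDerivAt).comp y h1
      refine h2.congr_fderiv ?_
      ext v; simp)
  refine key.congr_fderiv ?_
  rw [integral_smul]; rfl

lemma fderiv_mehler {u : E n → F} (hu : BddSmooth u) (θ : ℝ) :
    fderiv ℝ (mehler θ u) = fun x => Real.cos θ • mehler θ (fderiv ℝ u) x :=
  funext fun x => (hasFDerivAt_mehler hu θ x).fderiv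

/-- The codomain is quantified inside the induction because the step passes from `u` to `fderiv ℝ
u`, which takes values in another space. -/
lemma contDiff_nat_mehler (θ : ℝ) (k : ℕ) : ∀ {F : Type} [NormedAddCommGroup F] [NormedSpace ℝ F]
    {u : E n → F}, BddSmooth u → ContDiff ℝ k (mehler θ u) := by
  induction k with
  | zero =>
    intro F _ _ u hu
    exact contDiff_zero.2 (continuous_iff_continuousAt.2 fun x =>
      (hasFDerivAt_mehler hu θ x).continuousAt)
  | succ k ih =>
    intro F _ _ u hu
    rw [show ((k + 1 : ℕ) : ℕ∞ω) = (k : ℕ∞ω) + 1 by norm_cast, contDiff_succ_iff_fderiv]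
    refine ⟨fun x => (hasFDerivAt_mehler hu θ x).differentiableAt, by simp, ?_⟩
    rw [fderiv_mehler hu]
    exact (ih hu.fderiv).const_smul _

lemma exists_norm_iteratedFDeriv_mehler_le (θ : ℝ) (k : ℕ) :
    ∀ {F : Type} [NormedAddCommGroup F] [NormedSpace ℝ F] {u : E n → F}, BddSmooth u →
      ∃ C : ℝ, ∀ x, ‖iteratedFDeriv ℝ k (mehler θ u) x‖ ≤ C := by
  induction k with
  | zero =>
    intro F _ _ u hu
    obtain ⟨C, _, hC⟩ := hu.exists_norm_le
    exact ⟨C, fun x => by simpa using norm_mehler_le hC θ x⟩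
  | succ k ih =>
    intro F _ _ u hu
    obtain ⟨C, hC⟩ := ih hu.fderiv
    refine ⟨|Real.cos θ| * C, fun x => ?_⟩
    rw [← norm_iteratedFDeriv_fderiv, fderiv_mehler hu, iteratedFDeriv_const_smul_apply'
      (contDiff_nat_mehler θ k hu.fderiv).contDiffAt, norm_smul, Real.norm_eq_abs]
    exact mul_le_mul_of_nonneg_left (hC x) (abs_nonneg _)

lemma BddSmooth.mehler {u : E n → F} (hu : BddSmooth u) (θ : ℝ) : BddSmooth (mehler θ u) where
  contDiff := contDiff_infty.2 fun k => contDiff_nat_mehler θ k hu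
  bdd k := exists_norm_iteratedFDeriv_mehler_le θ k hu

lemma pd_mehler {u : E n → ℝ} (hu : BddSmooth u) (θ : ℝ) (i : Fin n) (x : E n) :
    pd i (mehler θ u) x = Real.cos θ * mehler θ (pd i u) x := by
  rw [pd, fderiv_mehler hu]
  simp only [smul_apply, smul_eq_mul, GaussLSI.mehler]
  rw [ContinuousLinearMap.integral_apply (hu.fderiv.integrable_comp_affine _ _ _ x)]
  rfl

lemma mehler_mem_Icc {u : E n → ℝ} (hu : BddSmooth u) {a b : ℝ} (h : ∀ x, u x ∈ Set.Icc a b)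
    (θ : ℝ) (x : E n) : mehler θ u x ∈ Set.Icc a b := by
  have hi := hu.integrable_comp_affine (γ n) (Real.cos θ) (Real.sin θ) x
  constructor
  · have := integral_mono (integrable_const a) hi fun z => (h _).1
    simpa [GaussLSI.mehler] using this
  · have := integral_mono hi (integrable_const b) fun z => (h _).2
    simpa [GaussLSI.mehler] using this

lemma mehler_zero (u : E n → F) [CompleteSpace F] : mehler 0 u = u := by
  ext x; simp [mehler]

lemma mehler_pi_div_two (u : E n → F) (x : E n) :
    mehler (Real.pi / 2) u x = ∫ z, u z ∂(γ n) := by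
  simp [mehler]

end mehler

/-! ### Smooth cutoffs -/

/-- Dilates of a single bump function: stretching by `k + 1` divides the gradient by `k + 1`, so
cutoff errors vanish in the limit. -/
lemma exists_smooth_cutoff (n : ℕ) : ∃ (χ : ℕ → E n → ℝ) (C : ℝ), 0 ≤ C ∧
    (∀ k, ContDiff ℝ ∞ (χ k)) ∧ (∀ k, HasCompactSupport (χ k)) ∧
    (∀ k x, 0 ≤ χ k x) ∧ (∀ k x, χ k x ≤ 1) ∧
    (∀ x, Filter.Tendsto (fun k => χ k x) Filter.atTop (nhds 1)) ∧
    (∀ k x, ‖fderiv ℝ (χ k) x‖ ≤ C * (1 / ((k : ℝ) + 1))) := by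
  let χ : ContDiffBump (0 : E n) := ⟨1, 2, one_pos, one_lt_two⟩
  have hχ : ContDiff ℝ ∞ χ := χ.contDiff
  obtain ⟨C, hC0, hC⟩ := (BddSmooth.of_hasCompactSupport hχ χ.hasCompactSupport).fderiv.exists_norm_le
  have hpos : ∀ k : ℕ, 0 < 1 / ((k : ℝ) + 1) := fun k => by positivity
  refine ⟨fun k x => χ ((1 / ((k : ℝ) + 1)) • x), C, hC0, fun k => hχ.comp (by fun_prop),
    fun k => ?_, fun k x => χ.nonneg, fun k x => χ.le_one, fun x => ?_, fun k x => ?_⟩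
  · exact χ.hasCompactSupport.comp_homeomorph (Homeomorph.smulOfNeZero _ (hpos k).ne')
  · apply tendsto_const_nhds.congr'
    have ht : Filter.Tendsto (fun k : ℕ => (1 / ((k : ℝ) + 1)) • x) Filter.atTop (nhds 0) := by
      have := (tendsto_one_div_add_atTop_nhds_zero_nat (𝕜 := ℝ)).smul_const x
      simpa using this
    filter_upwards [ht (Metric.closedBall_mem_nhds 0 one_pos)] with k hk
    exact (χ.one_of_mem_closedBall hk).symm
  · have h2 := ((hχ.differentiable (by simp) ((1 / ((k : ℝ) + 1)) • x)).hasFDerivAt).comp x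
      ((hasFDerivAt_id (𝕜 := ℝ) x).const_smul (1 / ((k : ℝ) + 1)))
    have h3 : HasFDerivAt (fun x => χ ((1 / ((k : ℝ) + 1)) • x)) _ x := h2
    rw [h3.fderiv, ContinuousLinearMap.comp_smul, norm_smul, Real.norm_of_nonneg (hpos k).le, mul_comm]
    refine mul_le_mul_of_nonneg_right ?_ (hpos k).le
    simpa using hC _

/-! ### The Gaussian density -/

/-- The density of the centered Gaussian measure with covariance `μ⁻¹` times the identity. -/
noncomputable def gaussDensity (n : ℕ) (μ : ℝ) (x : E n) : ℝ :=
  (μ / (2 * Real.pi)) ^ ((n : ℝ) / 2) * Real.exp (-(μ / 2) * ‖x‖ ^ 2)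

lemma gaussDensity_nonneg (n : ℕ) {μ : ℝ} (hμ : 0 < μ) (x : E n) : 0 ≤ gaussDensity n μ x := by
  have := Real.pi_pos
  unfold gaussDensity; positivity

lemma contDiff_gaussDensity (n : ℕ) (μ : ℝ) : ContDiff ℝ ∞ (gaussDensity n μ) := by
  unfold gaussDensity
  exact contDiff_const.mul ((contDiff_const.mul (contDiff_norm_sq ℝ)).exp)

lemma measurable_gaussDensity (n : ℕ) (μ : ℝ) : Measurable (gaussDensity n μ) :=
  (contDiff_gaussDensity n μ).continuous.measurable

lemma integrable_gaussDensity (n : ℕ) {μ : ℝ} (hμ : 0 < μ) :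
    Integrable (gaussDensity n μ) volume := by
  have h := GaussianFourier.integrable_cexp_neg_mul_sq_norm_add (V := E n) (b := (μ / 2 : ℝ))
    (by simpa using half_pos hμ) 0 0
  refine (h.norm.const_mul ((μ / (2 * Real.pi)) ^ ((n : ℝ) / 2))).congr
    (Filter.Eventually.of_forall fun x => ?_)
  simp only [gaussDensity, Complex.norm_exp]
  congr 2
  have : (-((μ / 2 : ℝ) : ℂ) * (‖x‖ : ℂ) ^ 2 + 0 * ((inner ℝ 0 x : ℝ) : ℂ))
    = ((-(μ / 2) * ‖x‖ ^ 2 : ℝ) : ℂ) := by push_cast; ring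
  rw [this, Complex.ofReal_re]

/-- Both sides are finite measures with characteristic function `exp(-‖t‖² / (2μ))`. The case `μ =
1` identifies the Lebesgue density of `γ`; the general case identifies the extremal measures. -/
lemma map_smul_gaussian (n : ℕ) {μ : ℝ} (hμ : 0 < μ) :
    (γ n).map (fun x => (Real.sqrt μ)⁻¹ • x) =
      volume.withDensity (fun x => ENNReal.ofReal (gaussDensity n μ x)) := by
  have hfin : IsFiniteMeasure
      ((volume : Measure (E n)).withDensity (fun x => ENNReal.ofReal (gaussDensity n μ x))) :=
    isFiniteMeasure_withDensity_ofReal (integrable_gaussDensity n hμ).2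
  have hmap : IsProbabilityMeasure ((γ n).map (fun x => (Real.sqrt μ)⁻¹ • x)) :=
    Measure.isProbabilityMeasure_map (by fun_prop)
  apply Measure.ext_of_charFun
  ext t
  have hs : 0 < Real.sqrt μ := Real.sqrt_pos.2 hμ
  have hpi := Real.pi_pos
  rw [charFun_map_smul, γ, charFun_stdGaussian, charFun_apply,
    integral_withDensity_eq_integral_toReal_smul (measurable_gaussDensity n μ).ennreal_ofReal
    (Filter.Eventually.of_forall fun x => ENNReal.ofReal_lt_top)]
  have h1 : ∀ x : E n, (ENNReal.ofReal (gaussDensity n μ x)).toReal •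
      Complex.exp (((inner ℝ x t : ℝ) : ℂ) * Complex.I) =
      (((μ / (2 * Real.pi)) ^ ((n : ℝ) / 2) : ℝ) : ℂ) *
      Complex.exp (-((μ / 2 : ℝ) : ℂ) * (‖x‖ : ℂ) ^ 2 + Complex.I * ((inner ℝ t x : ℝ) : ℂ)) := by
    intro x
    rw [ENNReal.toReal_ofReal (gaussDensity_nonneg n hμ x), Complex.real_smul, gaussDensity,
      Complex.ofReal_mul, mul_assoc, Complex.ofReal_exp, ← Complex.exp_add, real_inner_comm]
    congr 2
    push_cast
    ring
  simp_rw [h1]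
  rw [integral_const_mul, GaussianFourier.integral_cexp_neg_mul_sq_norm_add
    (by simpa using half_pos hμ)]
  have h2 : ((Real.pi : ℂ) / ((μ / 2 : ℝ) : ℂ)) ^ ((Module.finrank ℝ (E n) : ℂ) / 2) =
      (((2 * Real.pi / μ) ^ ((n : ℝ) / 2) : ℝ) : ℂ) := by
    rw [Complex.ofReal_cpow (by positivity)]
    congr 1
    · push_cast
      have : (μ : ℂ) ≠ 0 := by exact_mod_cast hμ.ne'
      field_simp
    · simp
  rw [h2, ← mul_assoc, ← Complex.ofReal_mul, ← Real.mul_rpow (by positivity) (by positivity),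
    show μ / (2 * Real.pi) * (2 * Real.pi / μ) = 1 by field_simp, Real.one_rpow,
    Complex.ofReal_one, one_mul]
  congr 1
  rw [norm_smul, Real.norm_of_nonneg (by positivity), Complex.ofReal_mul, mul_pow,
    ← Complex.ofReal_pow, inv_pow, Real.sq_sqrt hμ.le]
  have : (μ : ℂ) ≠ 0 := by exact_mod_cast hμ.ne'
  push_cast
  rw [Complex.I_sq]
  field_simp
  ring

lemma gamma_eq_withDensity (n : ℕ) :
    γ n = volume.withDensity (fun x => ENNReal.ofReal (gaussDensity n 1 x)) := by
  rw [← map_smul_gaussian n one_pos]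
  simp

lemma gamma_absolutelyContinuous (n : ℕ) : γ n ≪ volume := by
  rw [gamma_eq_withDensity]
  exact withDensity_absolutelyContinuous _ _

lemma integral_gamma {n : ℕ} (F : E n → ℝ) :
    ∫ x, F x ∂(γ n) = ∫ x, gaussDensity n 1 x * F x := by
  rw [gamma_eq_withDensity, integral_withDensity_eq_integral_toReal_smul
    (measurable_gaussDensity n 1).ennreal_ofReal
    (Filter.Eventually.of_forall fun x => ENNReal.ofReal_lt_top)]
  simp_rw [ENNReal.toReal_ofReal (gaussDensity_nonneg n one_pos _), smul_eq_mul]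

/-! ### Partial derivatives -/

section pd
variable {n : ℕ} {u v : E n → ℝ} {x : E n}

lemma pd_mul (i : Fin n) (hu : DifferentiableAt ℝ u x) (hv : DifferentiableAt ℝ v x) :
    pd i (fun y => u y * v y) x = u x * pd i v x + v x * pd i u x := by
  simp [pd, fderiv_fun_mul hu hv]

lemma pd_const_mul (i : Fin n) (a : ℝ) (hu : DifferentiableAt ℝ u x) :
    pd i (fun y => a * u y) x = a * pd i u x := by
  rw [pd, fderiv_const_mul hu]; simp [pd]

lemma abs_pd_le (i : Fin n) : |pd i u x| ≤ ‖fderiv ℝ u x‖ := by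
  simpa [pd] using (fderiv ℝ u x).le_opNorm (EuclideanSpace.single i 1)

lemma fderiv_apply_eq_sum (v : E n) : fderiv ℝ u x v = ∑ i, v i * pd i u x := by
  conv_lhs => rw [← (EuclideanSpace.basisFun (Fin n) ℝ).sum_repr v, map_sum]
  simp [pd]

lemma gradient_apply (i : Fin n) : gradient u x i = pd i u x := by
  have h := InnerProductSpace.toDual_symm_apply (𝕜 := ℝ) (x := EuclideanSpace.single i (1 : ℝ))
    (y := fderiv ℝ u x)
  rw [pd, ← h, gradient, EuclideanSpace.inner_single_right]
  simp

lemma norm_sq_eq_sum (v : E n) : ‖v‖ ^ 2 = ∑ i, v i ^ 2 := EuclideanSpace.real_norm_sq_eq v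

lemma abs_apply_le_norm (v : E n) (i : Fin n) : |v i| ≤ ‖v‖ := by
  simpa using PiLp.norm_apply_le v i

lemma norm_gradient : ‖gradient u x‖ = ‖fderiv ℝ u x‖ := by
  simp [gradient]

lemma pd_gaussDensity (i : Fin n) (x : E n) :
    pd i (gaussDensity n 1) x = - (x i * gaussDensity n 1 x) := by
  have h1 : HasFDerivAt (fun x : E n => -((1 : ℝ) / 2) * ‖x‖ ^ 2) _ x :=
    ((hasStrictFDerivAt_norm_sq x).hasFDerivAt).const_mul (-((1 : ℝ) / 2))
  have h2 : HasFDerivAt (gaussDensity n 1) _ x :=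
    (h1.exp).const_mul ((1 / (2 * Real.pi)) ^ ((n : ℝ) / 2))
  rw [pd, h2.fderiv]
  simp [gaussDensity, PiLp.inner_apply]
  ring

end pd

/-! ### Integration by parts -/

lemma integrable_coord_mul {n : ℕ} {f u : E n → ℝ} {μ : Measure (E n)}
    (hxf : Integrable (fun x => ‖x‖ * f x) μ) (hf : Integrable f μ) (hu : BddSmooth u)
    (i : Fin n) : Integrable (fun x => f x * (x i * u x)) μ := by
  obtain ⟨C, hC0, hC⟩ := hu.exists_norm_le
  have hm : Continuous fun x : E n => x i := by fun_prop
  refine (hxf.norm.const_mul C).mono'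
    (hf.aestronglyMeasurable.mul (hm.mul hu.continuous).aestronglyMeasurable) ?_
  refine Filter.Eventually.of_forall fun x => ?_
  have h1 := abs_apply_le_norm x i
  have h2 := hC x
  simp only [norm_mul, Real.norm_eq_abs, abs_norm] at *
  calc |f x| * (|x i| * |u x|) ≤ |f x| * (‖x‖ * C) := by gcongr
    _ = _ := by ring

/-- The Gaussian integration by parts formula for a function with a weak partial derivative. -/
lemma integral_by_parts {n : ℕ} {f g : E n → ℝ} (i : Fin n) (hf : Integrable f (γ n))
    (hxf : Integrable (fun x => ‖x‖ * f x) (γ n)) (hg : Integrable g (γ n))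
    (hw : ∀ φ : E n → ℝ, ContDiff ℝ ∞ φ → HasCompactSupport φ →
      ∫ x, f x * pd i φ x = - ∫ x, φ x * g x)
    {u : E n → ℝ} (hu : BddSmooth u) :
    ∫ x, f x * (x i * u x) ∂(γ n) - ∫ x, f x * pd i u x ∂(γ n) = ∫ x, g x * u x ∂(γ n) := by
  obtain ⟨χ, C, hC0, hχs, hχc, hχ0, hχ1, hχt, hχd⟩ := exists_smooth_cutoff n
  obtain ⟨A, hA0, hA⟩ := hu.exists_norm_le
  obtain ⟨B, hB0, hB⟩ := (hu.pd i).exists_norm_le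
  have hχdiff : ∀ k, Differentiable ℝ (χ k) := fun k => (hχs k).differentiable (by simp)
  have hχabs : ∀ k x, |χ k x| ≤ 1 := fun k x => by rw [abs_of_nonneg (hχ0 k x)]; exact hχ1 k x
  have hχpd : ∀ k x, |pd i (χ k) x| ≤ C := fun k x => by
    refine (abs_pd_le i).trans ((hχd k x).trans ?_)
    refine mul_le_of_le_one_right hC0 ?_
    rw [div_le_one (by positivity)]
    have : (0 : ℝ) ≤ k := Nat.cast_nonneg k
    linarith
  have hχpdt : ∀ x, Filter.Tendsto (fun k => pd i (χ k) x) Filter.atTop (nhds 0) := fun x => by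
    refine squeeze_zero_norm (fun k => (abs_pd_le i).trans (hχd k x)) ?_
    simpa using (tendsto_one_div_add_atTop_nhds_zero_nat (𝕜 := ℝ)).const_mul C
  have hχcont : ∀ k, Continuous (χ k) := fun k => (hχs k).continuous
  have hχpdcont : ∀ k, Continuous (pd i (χ k)) := fun k =>
    (BddSmooth.of_hasCompactSupport (hχs k) (hχc k)).pd i |>.continuous
  have hcoord : Continuous fun x : E n => x i := by fun_prop
  have hid : ∀ k, ∫ x, f x * (χ k x * pd i u x + u x * pd i (χ k) x - x i * u x * χ k x) ∂(γ n)
      = - ∫ x, u x * χ k x * g x ∂(γ n) := by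
    intro k
    -- Putting the Gaussian density into the test function converts the weak derivative for Lebesgue
    -- measure into a formula for `γ`; its derivative `-x_i` times itself produces the coordinate
    -- term.
    have h := hw (fun x => u x * χ k x * gaussDensity n 1 x)
      ((hu.contDiff.mul (hχs k)).mul (contDiff_gaussDensity n 1))
      (((hχc k).mul_left).mul_right)
    rw [integral_gamma, integral_gamma]
    convert h using 1
    · congr 1; ext x
      have hd := (contDiff_gaussDensity n 1).differentiable (by simp) x
      rw [pd_mul (u := fun y => u y * χ k y) i ((hu.differentiable x).mul (hχdiff k x)) hd,
        pd_mul i (hu.differentiable x) (hχdiff k x), pd_gaussDensity]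
      ring
    · congr 2; ext x; ring
  have hl : Filter.Tendsto (fun k => ∫ x, f x *
      (χ k x * pd i u x + u x * pd i (χ k) x - x i * u x * χ k x) ∂(γ n)) Filter.atTop
      (nhds (∫ x, f x * (1 * pd i u x + u x * 0 - x i * u x * 1) ∂(γ n))) := by
    refine tendsto_integral_of_dominated_convergence
      (fun x => |f x| * (B + A * C) + A * |‖x‖ * f x|) (fun k => ?_) ?_ (fun k => ?_) ?_
    · exact hf.aestronglyMeasurable.mul (Continuous.aestronglyMeasurable
        ((((hχcont k).mul (hu.pd i).continuous).add (hu.continuous.mul (hχpdcont k))).sub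
          ((hcoord.mul hu.continuous).mul (hχcont k))))
    · exact (hf.abs.mul_const _).add (hxf.abs.const_mul _)
    · refine Filter.Eventually.of_forall fun x => ?_
      have hA' : |u x| ≤ A := hA x
      have hB' : |pd i u x| ≤ B := hB x
      rw [Real.norm_eq_abs, abs_mul]
      have e1 : |χ k x * pd i u x + u x * pd i (χ k) x - x i * u x * χ k x|
          ≤ 1 * B + A * C + ‖x‖ * A * 1 := by
        refine (abs_sub _ _).trans (add_le_add ((abs_add_le _ _).trans (add_le_add ?_ ?_)) ?_)
        · rw [abs_mul]; exact mul_le_mul (hχabs k x) hB' (abs_nonneg _) zero_le_one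
        · rw [abs_mul]; exact mul_le_mul hA' (hχpd k x) (abs_nonneg _) hA0
        · rw [abs_mul, abs_mul]
          exact mul_le_mul (mul_le_mul (abs_apply_le_norm x i) hA' (abs_nonneg _) (norm_nonneg _))
            (hχabs k x) (abs_nonneg _) (by positivity)
      calc _ ≤ |f x| * (1 * B + A * C + ‖x‖ * A * 1) := by gcongr
        _ = _ := by rw [abs_mul, abs_norm]; ring
    · refine Filter.Eventually.of_forall fun x => ?_
      exact ((((hχt x).mul_const _).add ((hχpdt x).const_mul _)).sub
        ((hχt x).const_mul _)).const_mul _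
  have hr : Filter.Tendsto (fun k => - ∫ x, u x * χ k x * g x ∂(γ n)) Filter.atTop
      (nhds (- ∫ x, u x * 1 * g x ∂(γ n))) := by
    refine Filter.Tendsto.neg (tendsto_integral_of_dominated_convergence
      (fun x => A * |g x|) (fun k => ?_) (hg.abs.const_mul _) (fun k => ?_) ?_)
    · exact ((hu.continuous.mul (hχcont k)).aestronglyMeasurable).mul hg.aestronglyMeasurable
    · refine Filter.Eventually.of_forall fun x => ?_
      have hA' : |u x| ≤ A := hA x
      rw [Real.norm_eq_abs, abs_mul, abs_mul]
      calc _ ≤ A * 1 * |g x| := by gcongr; exact hχabs k x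
        _ = _ := by ring
    · exact Filter.Eventually.of_forall fun x => ((hχt x).const_mul _).mul_const _
  simp_rw [hid] at hl
  have hfin := tendsto_nhds_unique hr hl
  have i1 := integrable_coord_mul hxf hf hu i
  have i2 : Integrable (fun x => f x * pd i u x) (γ n) :=
    hf.mul_bdd (hu.pd i).continuous.aestronglyMeasurable (Filter.Eventually.of_forall hB)
  rw [← integral_sub i1 i2]
  rw [← neg_inj, ← integral_neg]
  calc _ = ∫ x, f x * (1 * pd i u x + u x * 0 - x i * u x * 1) ∂(γ n) := by
        congr 1; ext x; ring
    _ = _ := by rw [← hfin]; congr 2; ext x; ring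

lemma integrable_norm_gamma (n : ℕ) : Integrable (fun x : E n => ‖x‖) (γ n) :=
  IsGaussian.integrable_id.norm

/-- Stein's identity for the standard Gaussian measure. -/
lemma stein_gamma {n : ℕ} {u : E n → ℝ} (hu : BddSmooth u) (i : Fin n) :
    ∫ x, x i * u x ∂(γ n) = ∫ x, pd i u x ∂(γ n) := by
  have h := integral_by_parts (f := fun _ : E n => 1) (g := fun _ => 0) i (integrable_const _)
    (by simpa using integrable_norm_gamma n) (integrable_const _) (fun φ hφ hc => ?_) hu
  · simpa [sub_eq_zero] using h
  · have hb := BddSmooth.of_hasCompactSupport hφ hc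
    have hi : Integrable φ volume := hb.continuous.integrable_of_hasCompactSupport hc
    have hi' : Integrable (pd i φ) volume :=
      (hb.pd i).continuous.integrable_of_hasCompactSupport
        (hc.fderiv_apply (𝕜 := ℝ) (EuclideanSpace.single i 1))
    have := integral_mul_fderiv_eq_neg_fderiv_mul_of_integrable (μ := (volume : Measure (E n)))
      (f := fun _ => (1 : ℝ)) (g := φ) (v := EuclideanSpace.single i 1) (by simp)
      (by simp only [one_mul]; exact hi') (by simpa using hi) (fun _ _ => differentiableAt_const _)
      (fun _ _ => hb.differentiable _)
    simpa [pd] using this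

lemma BddSmooth.comp_affine {n : ℕ} {u : E n → ℝ} (hu : BddSmooth u) (y : E n) (s : ℝ) :
    BddSmooth (fun z => u (y + s • z)) where
  contDiff := hu.contDiff.comp (by fun_prop)
  bdd k := by
    have key : ∀ (k : ℕ) {F : Type} [NormedAddCommGroup F] [NormedSpace ℝ F] {u : E n → F},
        BddSmooth u → ∃ C : ℝ, ∀ x, ‖iteratedFDeriv ℝ k (fun z => u (y + s • z)) x‖ ≤ C := by
      intro k
      induction k with
      | zero =>
        intro F _ _ u hu
        obtain ⟨C, _, hC⟩ := hu.exists_norm_le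
        exact ⟨C, fun x => by simpa using hC _⟩
      | succ k ih =>
        intro F _ _ u hu
        obtain ⟨C, hC⟩ := ih hu.fderiv
        refine ⟨|s| * C, fun x => ?_⟩
        have hfd : _root_.fderiv ℝ (fun z => u (y + s • z)) = fun z => s • _root_.fderiv ℝ u (y + s • z) := by
          ext1 z
          have h1 : HasFDerivAt (fun z : E n => y + s • z) (s • ContinuousLinearMap.id ℝ (E n)) z :=
            ((hasFDerivAt_id (𝕜 := ℝ) z).const_smul s).const_add y
          have h2 := ((hu.differentiable _).hasFDerivAt).comp z h1
          have h3 : HasFDerivAt (fun z => u (y + s • z)) _ z := h2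
          rw [h3.fderiv]
          ext v; simp
        have hcd : ContDiff ℝ k (fun z => _root_.fderiv ℝ u (y + s • z)) :=
          (hu.fderiv.contDiff.of_le (by exact_mod_cast le_top)).comp (by fun_prop)
        rw [← norm_iteratedFDeriv_fderiv, hfd, iteratedFDeriv_const_smul_apply' hcd.contDiffAt,
          norm_smul, Real.norm_eq_abs]
        exact mul_le_mul_of_nonneg_left (hC x) (abs_nonneg _)
    exact key k hu

lemma pd_comp_affine {n : ℕ} {u : E n → ℝ} (hu : BddSmooth u) (y : E n) (s : ℝ) (i : Fin n)
    (z : E n) : pd i (fun z => u (y + s • z)) z = s * pd i u (y + s • z) := by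
  have h1 : HasFDerivAt (fun z : E n => y + s • z) (s • ContinuousLinearMap.id ℝ (E n)) z :=
    ((hasFDerivAt_id (𝕜 := ℝ) z).const_smul s).const_add y
  have h2 := ((hu.differentiable _).hasFDerivAt).comp z h1
  have h3 : HasFDerivAt (fun z => u (y + s • z)) _ z := h2
  rw [pd, h3.fderiv]
  simp [pd]

/-- Stein's identity after an affine change of variables. -/
lemma stein_mehler {n : ℕ} {u : E n → ℝ} (hu : BddSmooth u) (θ : ℝ) (i : Fin n) (x : E n) :
    ∫ z, z i * u (Real.cos θ • x + Real.sin θ • z) ∂(γ n) = Real.sin θ * mehler θ (pd i u) x := by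
  rw [stein_gamma (hu.comp_affine (Real.cos θ • x) (Real.sin θ)) i]
  simp_rw [pd_comp_affine hu]
  rw [integral_const_mul]; rfl

/-! ### Integrals over `ν ⊗ γ` -/

section prod

variable {n : ℕ} {ν : Measure (E n)} {w : E n → ℝ}

lemma integrable_norm_fst (hν : Integrable (fun x : E n => ‖x‖) ν) :
    Integrable (fun p : E n × E n => ‖p.1‖) (ν.prod (γ n)) := hν.comp_fst (γ n)

variable [IsProbabilityMeasure ν]

lemma integrable_prod_rotation (hw : Continuous w) {C : ℝ} (hC : ∀ x, |w x| ≤ C) (θ : ℝ) :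
    Integrable (fun p : E n × E n => w (Real.cos θ • p.1 + Real.sin θ • p.2)) (ν.prod (γ n)) :=
  Integrable.of_bound (hw.comp (by fun_prop)).aestronglyMeasurable C
    (Filter.Eventually.of_forall fun _ => hC _)

lemma integral_prod_rotation (hw : Continuous w) {C : ℝ} (hC : ∀ x, |w x| ≤ C) (θ : ℝ) :
    ∫ p : E n × E n, w (Real.cos θ • p.1 + Real.sin θ • p.2) ∂(ν.prod (γ n))
      = ∫ x, mehler θ w x ∂ν := by
  rw [integral_prod _ (integrable_prod_rotation hw hC θ)]; rfl

lemma integrable_norm_snd :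
    Integrable (fun p : E n × E n => ‖p.2‖) (ν.prod (γ n)) := (integrable_norm_gamma n).comp_snd ν

lemma integrable_fst_mul (hν : Integrable (fun x : E n => ‖x‖) ν) (hw : Continuous w) {C : ℝ}
    (hC : ∀ x, |w x| ≤ C) (θ : ℝ) (i : Fin n) :
    Integrable (fun p : E n × E n => p.1 i * w (Real.cos θ • p.1 + Real.sin θ • p.2))
      (ν.prod (γ n)) := by
  have h1 : Integrable (fun p : E n × E n => p.1 i) (ν.prod (γ n)) :=
    (integrable_norm_fst hν).mono' (by fun_prop)
      (Filter.Eventually.of_forall fun p => abs_apply_le_norm p.1 i)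
  exact h1.mul_bdd (integrable_prod_rotation hw hC θ).aestronglyMeasurable
    (Filter.Eventually.of_forall fun _ => hC _)

lemma integrable_snd_mul (hw : Continuous w) {C : ℝ}
    (hC : ∀ x, |w x| ≤ C) (θ : ℝ) (i : Fin n) :
    Integrable (fun p : E n × E n => p.2 i * w (Real.cos θ • p.1 + Real.sin θ • p.2))
      (ν.prod (γ n)) := by
  have h1 : Integrable (fun p : E n × E n => p.2 i) (ν.prod (γ n)) :=
    (integrable_norm_snd).mono' (by fun_prop)
      (Filter.Eventually.of_forall fun p => abs_apply_le_norm p.2 i)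
  exact h1.mul_bdd (integrable_prod_rotation hw hC θ).aestronglyMeasurable
    (Filter.Eventually.of_forall fun _ => hC _)

lemma integral_fst_mul (hν : Integrable (fun x : E n => ‖x‖) ν) (hw : Continuous w) {C : ℝ}
    (hC : ∀ x, |w x| ≤ C) (θ : ℝ) (i : Fin n) :
    ∫ p : E n × E n, p.1 i * w (Real.cos θ • p.1 + Real.sin θ • p.2) ∂(ν.prod (γ n))
      = ∫ x, x i * mehler θ w x ∂ν := by
  rw [integral_prod _ (integrable_fst_mul hν hw hC θ i)]
  congr 1; ext x
  exact integral_const_mul (x i) fun z => w (Real.cos θ • x + Real.sin θ • z)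

lemma integral_snd_mul (hw : BddSmooth w) (θ : ℝ) (i : Fin n) :
    ∫ p : E n × E n, p.2 i * w (Real.cos θ • p.1 + Real.sin θ • p.2) ∂(ν.prod (γ n))
      = Real.sin θ * ∫ x, mehler θ (pd i w) x ∂ν := by
  obtain ⟨C, _, hC⟩ := hw.exists_norm_le
  rw [integral_prod _ (integrable_snd_mul hw.continuous hC θ i)]
  simp_rw [stein_mehler hw]
  rw [integral_const_mul]

end prod

/-! ### The derivative along the rotation -/

section deriv

variable {n : ℕ}

/-- The derivative in `θ` of `mehler θ h (cos θ • x + sin θ • z)`. -/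
noncomputable def rotDeriv (h : E n → ℝ) (θ : ℝ) (x z : E n) : ℝ :=
  ∑ i, ((-2 * Real.cos θ * Real.sin θ * x i + (Real.cos θ ^ 2 - Real.sin θ ^ 2) * z i) *
      mehler θ (pd i h) (Real.cos θ • x + Real.sin θ • z) +
    Real.cos θ * Real.sin θ * mehler θ (pd i (pd i h)) (Real.cos θ • x + Real.sin θ • z))

/-- Along the path `cos θ (cos θ x + sin θ z) + sin θ w`, the velocity has components along `x`, `z`
and the integration variable `w`. Stein's identity in `w` turns the last one into the
second-derivative term of `rotDeriv`. The bound, linear in `‖x‖ + ‖z‖` and uniform in `θ`, later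
dominates over `ν ⊗ γ`, where only first moments are available. -/
lemma hasDerivAt_mehler_rotation {h : E n → ℝ} (hh : BddSmooth h) :
    ∃ C : ℝ, 0 ≤ C ∧ ∀ (θ : ℝ) (x z : E n),
      HasDerivAt (fun θ => mehler θ h (Real.cos θ • x + Real.sin θ • z)) (rotDeriv h θ x z) θ ∧
      |rotDeriv h θ x z| ≤ C * (1 + ‖x‖ + ‖z‖) := by
  obtain ⟨C, hC0, hC⟩ := hh.fderiv.exists_norm_le
  set m := ∫ w, ‖w‖ ∂(γ n) with hm
  have hm0 : 0 ≤ m := integral_nonneg fun _ => norm_nonneg _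
  refine ⟨C * (2 + m), by positivity, fun θ x z => ?_⟩
  let N : ℝ → E n → E n := fun θ w =>
    Real.cos θ • (Real.cos θ • x + Real.sin θ • z) + Real.sin θ • w
  let N' : ℝ → E n → E n := fun θ w =>
    (-2 * Real.cos θ * Real.sin θ) • x + (Real.cos θ ^ 2 - Real.sin θ ^ 2) • z + Real.cos θ • w
  have hN : ∀ θ w, HasDerivAt (fun θ => N θ w) (N' θ w) θ := by
    intro θ w
    have h1 := ((Real.hasDerivAt_cos θ).smul
      (((Real.hasDerivAt_cos θ).smul_const x).add ((Real.hasDerivAt_sin θ).smul_const z))).add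
      ((Real.hasDerivAt_sin θ).smul_const w)
    refine h1.congr_deriv ?_
    simp only [N', Pi.add_apply]
    module
  have hN' : ∀ θ w, ‖N' θ w‖ ≤ 2 * ‖x‖ + 2 * ‖z‖ + ‖w‖ := by
    intro θ w
    have c1 := Real.abs_cos_le_one θ
    have s1 := Real.abs_sin_le_one θ
    refine (norm_add_le _ _).trans (add_le_add ((norm_add_le _ _).trans (add_le_add ?_ ?_)) ?_)
    · rw [norm_smul]
      gcongr
      rw [Real.norm_eq_abs, abs_mul, abs_mul, abs_neg, abs_two]
      nlinarith [abs_nonneg (Real.cos θ), abs_nonneg (Real.sin θ)]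
    · rw [norm_smul]
      gcongr
      rw [Real.norm_eq_abs, abs_le]
      constructor <;> nlinarith [Real.sin_sq_add_cos_sq θ, sq_nonneg (Real.cos θ),
        sq_nonneg (Real.sin θ)]
    · rw [norm_smul, Real.norm_eq_abs]
      exact mul_le_of_le_one_left (norm_nonneg _) c1
  have hNc : ∀ θ, Continuous (N θ) := fun θ => by fun_prop
  have hNc' : ∀ θ, Continuous (N' θ) := fun θ => by fun_prop
  have hb : ∀ θ w, ‖fderiv ℝ h (N θ w) (N' θ w)‖ ≤ C * (2 * ‖x‖ + 2 * ‖z‖ + ‖w‖) := fun θ w =>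
    ((fderiv ℝ h (N θ w)).le_opNorm _).trans
      (mul_le_mul (hC _) (hN' θ w) (norm_nonneg _) hC0)
  have hbi : Integrable (fun w : E n => C * (2 * ‖x‖ + 2 * ‖z‖ + ‖w‖)) (γ n) :=
    ((integrable_const _).add (integrable_norm_gamma n)).const_mul C
  have key := hasDerivAt_integral_of_dominated_loc_of_deriv_le (μ := γ n) (𝕜 := ℝ)
    (F := fun θ w => h (N θ w)) (F' := fun θ w => fderiv ℝ h (N θ w) (N' θ w))
    (x₀ := θ) (s := Set.univ) (bound := fun w => C * (2 * ‖x‖ + 2 * ‖z‖ + ‖w‖)) Filter.univ_mem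
    (Filter.Eventually.of_forall fun θ => (hh.continuous.comp (hNc θ)).aestronglyMeasurable)
    (hh.integrable_comp_affine _ _ _ _)
    ((hh.fderiv.continuous.comp (hNc θ)).clm_apply (hNc' θ)).aestronglyMeasurable
    (Filter.Eventually.of_forall fun w θ _ => hb θ w) hbi
    (Filter.Eventually.of_forall fun w θ _ =>
      ((hh.differentiable _).hasFDerivAt).comp_hasDerivAt θ (hN θ w))
  have heq : ∫ w, fderiv ℝ h (N θ w) (N' θ w) ∂(γ n) = rotDeriv h θ x z := by
    simp_rw [fderiv_apply_eq_sum]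
    have hint1 : ∀ i, Integrable (fun w => (-2 * Real.cos θ * Real.sin θ * x i +
        (Real.cos θ ^ 2 - Real.sin θ ^ 2) * z i) * pd i h (N θ w)) (γ n) := fun i =>
      ((hh.pd i).integrable_comp_affine _ _ _ _).const_mul _
    have hint2 : ∀ i, Integrable (fun w => Real.cos θ * (w i * pd i h (N θ w))) (γ n) := by
      intro i
      refine Integrable.const_mul ?_ _
      have h1 : Integrable (fun w : E n => w i) (γ n) :=
        (integrable_norm_gamma n).mono' (by fun_prop)
          (Filter.Eventually.of_forall fun p => abs_apply_le_norm p i)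
      obtain ⟨D, _, hD⟩ := (hh.pd i).exists_norm_le
      exact h1.mul_bdd ((hh.pd i).integrable_comp_affine _ _ _ _).aestronglyMeasurable
        (Filter.Eventually.of_forall fun _ => hD _)
    have hsplit : ∀ w i, (N' θ w) i * pd i h (N θ w) = (-2 * Real.cos θ * Real.sin θ * x i +
        (Real.cos θ ^ 2 - Real.sin θ ^ 2) * z i) * pd i h (N θ w) +
        Real.cos θ * (w i * pd i h (N θ w)) := by
      intro w i
      simp only [N', PiLp.add_apply, PiLp.smul_apply, smul_eq_mul]
      ring
    simp_rw [hsplit]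
    rw [integral_finsetSum _ fun i _ => by exact (hint1 i).add (hint2 i)]
    refine Finset.sum_congr rfl fun i _ => ?_
    rw [integral_add (hint1 i) (hint2 i), integral_const_mul, integral_const_mul,
      stein_mehler (hh.pd i)]
    rw [mul_assoc (Real.cos θ)]; rfl
  rw [heq] at key
  refine ⟨key.2, ?_⟩
  rw [← heq]
  have h2 : |∫ w, fderiv ℝ h (N θ w) (N' θ w) ∂(γ n)| ≤ C * (2 * ‖x‖ + 2 * ‖z‖ + m) := by
    refine (norm_integral_le_of_norm_le hbi (Filter.Eventually.of_forall fun w => hb θ w)).trans ?_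
    rw [integral_const_mul, integral_add (integrable_const _) (integrable_norm_gamma n)]
    simp [hm]
  refine h2.trans ?_
  rw [mul_assoc]
  refine mul_le_mul_of_nonneg_left ?_ hC0
  nlinarith [norm_nonneg x, norm_nonneg z]

lemma continuous_rotDeriv {h : E n → ℝ} (hh : BddSmooth h) (θ : ℝ) :
    Continuous fun p : E n × E n => rotDeriv h θ p.1 p.2 := by
  unfold rotDeriv
  have h1 : ∀ i, Continuous (mehler θ (pd i h)) := fun i => ((hh.pd i).mehler θ).continuous
  have h2 : ∀ i, Continuous (mehler θ (pd i (pd i h))) := fun i =>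
    (((hh.pd i).pd i).mehler θ).continuous
  fun_prop

variable {ν : Measure (E n)} [IsProbabilityMeasure ν] {h : E n → ℝ} {φ : ℝ → ℝ} {U : Set ℝ}
  {a b : ℝ}

/-- Differentiation along the rotation, before integrating by parts. -/
lemma hasDerivAt_interpolation (hν : Integrable (fun x : E n => ‖x‖) ν) (hh : BddSmooth h)
    (hU : IsOpen U) (hφ : ContDiffOn ℝ ∞ φ U) (hab : Set.Icc a b ⊆ U)
    (hr : ∀ x, h x ∈ Set.Icc a b) (θ : ℝ) :
    HasDerivAt (fun θ => ∫ x, mehler θ (fun y => φ (mehler θ h y)) x ∂ν)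
      (∫ p : E n × E n, deriv φ (mehler θ h (Real.cos θ • p.1 + Real.sin θ • p.2)) *
        rotDeriv h θ p.1 p.2 ∂(ν.prod (γ n))) θ := by
  obtain ⟨C, hC0, hC⟩ := hasDerivAt_mehler_rotation hh
  have hφ' : ContinuousOn (deriv φ) (Set.Icc a b) :=
    (hφ.continuousOn_deriv_of_isOpen hU (by simp)).mono hab
  obtain ⟨M, hM⟩ := isCompact_Icc.exists_bound_of_continuousOn hφ'
  have hM0 : 0 ≤ M := (norm_nonneg _).trans (hM _ (hr 0))
  have hmem : ∀ θ x, mehler θ h x ∈ Set.Icc a b := fun θ x => mehler_mem_Icc hh hr θ x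
  have hψ : ∀ θ, BddSmooth (fun y => φ (mehler θ h y)) := fun θ =>
    (hh.mehler θ).comp hU hφ hab (hmem θ)
  have hrep : ∀ θ, ∫ x, mehler θ (fun y => φ (mehler θ h y)) x ∂ν =
      ∫ p : E n × E n, φ (mehler θ h (Real.cos θ • p.1 + Real.sin θ • p.2)) ∂(ν.prod (γ n)) := by
    intro θ
    obtain ⟨D, _, hD⟩ := (hψ θ).exists_norm_le
    exact (integral_prod_rotation (hψ θ).continuous hD θ).symm
  have hint : ∀ θ, Integrable (fun p : E n × E n =>
      φ (mehler θ h (Real.cos θ • p.1 + Real.sin θ • p.2))) (ν.prod (γ n)) := by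
    intro θ
    obtain ⟨D, _, hD⟩ := (hψ θ).exists_norm_le
    exact integrable_prod_rotation (w := fun y => φ (mehler θ h y)) (hψ θ).continuous hD θ
  simp_rw [hrep]
  have hrot : ∀ θ : ℝ, Continuous fun p : E n × E n => Real.cos θ • p.1 + Real.sin θ • p.2 :=
    fun θ => by fun_prop
  refine (hasDerivAt_integral_of_dominated_loc_of_deriv_le (𝕜 := ℝ)
    (F := fun θ (p : E n × E n) => φ (mehler θ h (Real.cos θ • p.1 + Real.sin θ • p.2)))
    (F' := fun θ (p : E n × E n) => deriv φ (mehler θ h (Real.cos θ • p.1 + Real.sin θ • p.2)) *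
        rotDeriv h θ p.1 p.2) (x₀ := θ) (s := Set.univ)
    (bound := fun p => M * (C * (1 + ‖p.1‖ + ‖p.2‖))) Filter.univ_mem
    (Filter.Eventually.of_forall fun θ => (hint θ).aestronglyMeasurable) (hint θ) ?_ ?_ ?_ ?_).2
  · have h1 : Continuous fun p : E n × E n =>
        deriv φ (mehler θ h (Real.cos θ • p.1 + Real.sin θ • p.2)) :=
      hφ'.comp_continuous ((hh.mehler θ).continuous.comp (hrot θ)) fun p => hmem θ _
    exact (h1.mul (continuous_rotDeriv hh θ)).aestronglyMeasurable
  · refine Filter.Eventually.of_forall fun p θ _ => ?_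
    rw [norm_mul]
    exact mul_le_mul (hM _ (hmem θ _)) (hC θ p.1 p.2).2 (norm_nonneg _) hM0
  · exact ((((integrable_const 1).add (integrable_norm_fst hν)).add
      integrable_norm_snd).const_mul C).const_mul M
  · refine Filter.Eventually.of_forall fun p θ _ => ?_
    have h1 : HasDerivAt φ (deriv φ (mehler θ h (Real.cos θ • p.1 + Real.sin θ • p.2))) _ :=
      ((hφ.contDiffAt (hU.mem_nhds (hab (hmem θ _)))).differentiableAt (by simp)).hasDerivAt
    exact h1.comp θ (hC θ p.1 p.2).1

lemma pd_comp (hU : IsOpen U) (hφ : ContDiffOn ℝ ∞ φ U) {k : E n → ℝ} (hk : BddSmooth k)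
    {x : E n} (hx : k x ∈ U) (i : Fin n) :
    pd i (fun y => φ (k y)) x = deriv φ (k x) * pd i k x := by
  have h1 := ((hφ.contDiffAt (hU.mem_nhds hx)).differentiableAt (by simp)).hasDerivAt
  have h2 : HasFDerivAt (fun y => φ (k y)) _ x :=
    h1.comp_hasFDerivAt x (hk.differentiable x).hasFDerivAt
  rw [pd, h2.fderiv]
  simp [pd]

/-- Integration by parts of the derivative along the rotation. -/
lemma integral_rotDeriv (hν : Integrable (fun x : E n => ‖x‖) ν) (hh : BddSmooth h)
    (hU : IsOpen U) (hφ : ContDiffOn ℝ ∞ φ U) (hab : Set.Icc a b ⊆ U)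
    (hr : ∀ x, h x ∈ Set.Icc a b) {S : Fin n → (E n → ℝ) → ℝ}
    (hS : ∀ i u, BddSmooth u → ∫ x, x i * u x ∂ν = ∫ x, pd i u x ∂ν + S i u)
    {θ : ℝ} (hθ : Real.cos θ ≠ 0) {e : Fin n → E n → ℝ} (hec : ∀ i, Continuous (e i))
    (heb : ∀ i, ∃ C, ∀ x, |e i x| ≤ C)
    (he : ∀ i x, pd i (pd i (fun y => φ (mehler θ h y))) x =
      deriv φ (mehler θ h x) * pd i (pd i (mehler θ h)) x + e i x) :
    ∫ p : E n × E n, deriv φ (mehler θ h (Real.cos θ • p.1 + Real.sin θ • p.2)) *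
        rotDeriv h θ p.1 p.2 ∂(ν.prod (γ n)) =
      ∑ i, (-2 * Real.sin θ * S i (mehler θ (pd i (fun y => φ (mehler θ h y)))) -
        Real.sin θ / Real.cos θ * ∫ x, mehler θ (e i) x ∂ν) := by
  set ψ : E n → ℝ := fun y => φ (mehler θ h y) with hψdef
  have hmem : ∀ x, mehler θ h x ∈ Set.Icc a b := fun x => mehler_mem_Icc hh hr θ x
  have hψ : BddSmooth ψ := (hh.mehler θ).comp hU hφ hab hmem
  have hpdk : ∀ i, pd i (mehler θ h) = fun x => Real.cos θ * mehler θ (pd i h) x := fun i =>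
    funext fun x => pd_mehler hh θ i x
  have hpdpdk : ∀ i x, pd i (pd i (mehler θ h)) x =
      Real.cos θ ^ 2 * mehler θ (pd i (pd i h)) x := by
    intro i x
    rw [hpdk]
    have hd := ((hh.pd i).mehler θ).differentiable x
    rw [pd_const_mul i _ hd, pd_mehler (hh.pd i)]; ring
  -- The chain rule and commutation give `φ'(P_θ h) P_θ ∂_i h = ∂_i ψ / cos θ`, while `he` trades
  -- the second-order term for `∂_i ∂_i ψ - e_i`. Everything is then linear in derivatives of `ψ`,
  -- ready for integration by parts. For `ν` that costs the defect `S i` in Stein's identity.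
  have hpt : ∀ p : E n × E n, deriv φ (mehler θ h (Real.cos θ • p.1 + Real.sin θ • p.2)) *
      rotDeriv h θ p.1 p.2 = ∑ i,
        ((-2 * Real.sin θ) * (p.1 i * pd i ψ (Real.cos θ • p.1 + Real.sin θ • p.2)) +
        ((Real.cos θ ^ 2 - Real.sin θ ^ 2) / Real.cos θ) *
          (p.2 i * pd i ψ (Real.cos θ • p.1 + Real.sin θ • p.2)) +
        (Real.sin θ / Real.cos θ) * pd i (pd i ψ) (Real.cos θ • p.1 + Real.sin θ • p.2) -
        (Real.sin θ / Real.cos θ) * e i (Real.cos θ • p.1 + Real.sin θ • p.2)) := by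
    intro p
    rw [rotDeriv, Finset.mul_sum]
    refine Finset.sum_congr rfl fun i _ => ?_
    set Y := Real.cos θ • p.1 + Real.sin θ • p.2
    rw [he, hpdpdk, pd_comp hU hφ (hh.mehler θ) (hab (hmem Y)), pd_mehler hh]
    field_simp
    ring
  simp_rw [hpt]
  choose D hD using heb
  have hb1 := fun i => (hψ.pd i).exists_norm_le
  have hb2 := fun i => ((hψ.pd i).pd i).exists_norm_le
  choose D1 _ hD1 using hb1
  choose D2 _ hD2 using hb2
  have i1 := fun i => (integrable_fst_mul hν (hψ.pd i).continuous (hD1 i) θ i).const_mul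
    (-2 * Real.sin θ)
  have i2 := fun i => (integrable_snd_mul (ν := ν) (hψ.pd i).continuous (hD1 i) θ i).const_mul
    ((Real.cos θ ^ 2 - Real.sin θ ^ 2) / Real.cos θ)
  have i3 := fun i => (integrable_prod_rotation (ν := ν) ((hψ.pd i).pd i).continuous
    (hD2 i) θ).const_mul (Real.sin θ / Real.cos θ)
  have i4 := fun i => (integrable_prod_rotation (ν := ν) (hec i) (hD i) θ).const_mul
    (Real.sin θ / Real.cos θ)
  rw [integral_finsetSum _ fun i _ => by exact (((i1 i).add (i2 i)).add (i3 i)).sub (i4 i)]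
  refine Finset.sum_congr rfl fun i _ => ?_
  rw [integral_sub (by exact ((i1 i).add (i2 i)).add (i3 i)) (i4 i),
    integral_add (by exact (i1 i).add (i2 i)) (i3 i), integral_add (i1 i) (i2 i)]
  simp_rw [integral_const_mul]
  rw [integral_fst_mul hν (hψ.pd i).continuous (hD1 i), integral_snd_mul (hψ.pd i),
    integral_prod_rotation ((hψ.pd i).pd i).continuous (hD2 i),
    integral_prod_rotation (hec i) (hD i), hS i _ ((hψ.pd i).mehler θ)]
  simp_rw [pd_mehler (hψ.pd i)]
  rw [integral_const_mul]
  have hcs := Real.sin_sq_add_cos_sq θ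
  field_simp
  -- The integral of `P_θ ∂_i ∂_i ψ` has total coefficient `(sin θ / cos θ)(-2 cos²θ + cos²θ - sin²θ
  -- + 1) = 0`.
  linear_combination (Real.sin θ * ∫ x, mehler θ (pd i (pd i ψ)) x ∂ν) * (-hcs)

end deriv

/-! ### Reverse Poincaré inequality for the Mehler operators -/

section bessel

variable {n : ℕ}

lemma integral_inner_gamma (a : E n) : ∫ z, inner ℝ a z ∂(γ n) = 0 := by
  have := integral_strongDual_stdGaussian (innerSL ℝ a)
  simpa [γ] using this

lemma memLp_inner_gamma (a : E n) : MemLp (fun z => inner ℝ a z) 2 (γ n) :=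
  IsGaussian.memLp_dual (γ n) (innerSL ℝ a) 2 (by simp)

lemma integral_inner_sq_gamma (a : E n) : ∫ z, (inner ℝ a z : ℝ) ^ 2 ∂(γ n) = ‖a‖ ^ 2 := by
  have h := variance_dual_stdGaussian (innerSL ℝ a)
  rw [variance_eq_integral (innerSL ℝ a).continuous.aemeasurable,
    integral_strongDual_stdGaussian, innerSL_apply_norm] at h
  simpa [γ] using h

lemma integrable_coord_gamma (i : Fin n) : Integrable (fun z : E n => z i) (γ n) :=
  (integrable_norm_gamma n).mono' (by fun_prop)
    (Filter.Eventually.of_forall fun p => abs_apply_le_norm p i)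

/-- Bessel's inequality for the first Hermite functions. -/
lemma sum_sq_integral_coord_mul_le {v : E n → ℝ} (hv : Continuous v) {C : ℝ}
    (hC : ∀ x, |v x| ≤ C) :
    ∑ i, (∫ z, z i * v z ∂(γ n)) ^ 2 ≤ ∫ z, v z ^ 2 ∂(γ n) - (∫ z, v z ∂(γ n)) ^ 2 := by
  let a : E n := WithLp.toLp 2 fun i => ∫ z, z i * v z ∂(γ n)
  set m := ∫ z, v z ∂(γ n)
  have hvi : Integrable v (γ n) :=
    Integrable.of_bound hv.aestronglyMeasurable C (Filter.Eventually.of_forall hC)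
  have hv2 : Integrable (fun z => v z ^ 2) (γ n) :=
    Integrable.of_bound (hv.pow 2).aestronglyMeasurable (C ^ 2)
      (Filter.Eventually.of_forall fun z => by
        rw [norm_pow]; exact pow_le_pow_left₀ (norm_nonneg _) (hC z) 2)
  have hi1 : ∀ i, Integrable (fun z : E n => z i * v z) (γ n) := fun i =>
    (integrable_coord_gamma i).mul_bdd hv.aestronglyMeasurable (Filter.Eventually.of_forall hC)
  have hinner : ∀ z, (inner ℝ a z : ℝ) = ∑ i, a i * z i := fun z => by
    simp [PiLp.inner_apply, mul_comm]
  have hl : Integrable (fun z => (inner ℝ a z : ℝ)) (γ n) :=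
    (memLp_inner_gamma a).integrable one_le_two
  have hl2 : Integrable (fun z => (inner ℝ a z : ℝ) ^ 2) (γ n) := (memLp_inner_gamma a).integrable_sq
  have hlv : Integrable (fun z => (inner ℝ a z : ℝ) * v z) (γ n) :=
    hl.mul_bdd hv.aestronglyMeasurable (Filter.Eventually.of_forall hC)
  have hlvint : ∫ z, (inner ℝ a z : ℝ) * v z ∂(γ n) = ‖a‖ ^ 2 := by
    simp_rw [hinner, Finset.sum_mul, mul_assoc]
    rw [integral_finsetSum _ fun i _ => (hi1 i).const_mul _, norm_sq_eq_sum]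
    refine Finset.sum_congr rfl fun i _ => ?_
    rw [integral_const_mul, sq]
  -- The residual of `v` after projection onto constants and linear functions, with `a` the vector
  -- of first Hermite coefficients; expanding the square gives Bessel's inequality.
  have hnn : 0 ≤ ∫ z, (v z - m - inner ℝ a z) ^ 2 ∂(γ n) := integral_nonneg fun z => sq_nonneg _
  have hex : ∀ z, (v z - m - inner ℝ a z) ^ 2 = (v z ^ 2 - 2 * m * v z + m ^ 2) +
      ((inner ℝ a z : ℝ) ^ 2 - 2 * ((inner ℝ a z : ℝ) * v z) + 2 * m * inner ℝ a z) :=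
    fun z => by ring
  simp_rw [hex] at hnn
  have j1 := (hv2.sub (hvi.const_mul (2 * m))).add (integrable_const (m ^ 2))
  have j2 := (hl2.sub (hlv.const_mul 2)).add (hl.const_mul (2 * m))
  rw [integral_add (by exact j1) (by exact j2),
    integral_add (by exact hv2.sub (hvi.const_mul (2 * m))) (integrable_const _),
    integral_sub hv2 (hvi.const_mul _),
    integral_add (by exact hl2.sub (hlv.const_mul 2)) (hl.const_mul _),
    integral_sub hl2 (hlv.const_mul _), integral_const_mul, integral_const_mul,
    integral_const_mul, hlvint, integral_inner_sq_gamma, integral_inner_gamma] at hnn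
  have ha : ‖a‖ ^ 2 = ∑ i, (∫ z, z i * v z ∂(γ n)) ^ 2 := norm_sq_eq_sum a
  simp only [integral_const, probReal_univ, smul_eq_mul, one_mul] at hnn
  rw [← ha]
  nlinarith [hnn]

lemma bddSmooth_sq {w : E n → ℝ} (hw : BddSmooth w) : BddSmooth (fun x => w x ^ 2) := by
  obtain ⟨C, _, hC⟩ := hw.exists_norm_le
  exact BddSmooth.comp (φ := fun t => t ^ 2) isOpen_univ (by fun_prop) (Set.subset_univ _) hw
    (fun x => abs_le.1 (hC x))

/-- The reverse local Poincaré inequality. -/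
lemma sum_sq_pd_mehler_le {w : E n → ℝ} (hw : BddSmooth w) (θ : ℝ) (x : E n) :
    Real.sin θ ^ 2 * ∑ i, pd i (mehler θ w) x ^ 2 ≤
      Real.cos θ ^ 2 * (mehler θ (fun y => w y ^ 2) x - mehler θ w x ^ 2) := by
  obtain ⟨C, _, hC⟩ := hw.exists_norm_le
  have h := sum_sq_integral_coord_mul_le
    (v := fun z => w (Real.cos θ • x + Real.sin θ • z)) (hw.continuous.comp (by fun_prop))
    (fun _ => hC _)
  -- By Stein's identity, the first Hermite coefficients of `z ↦ w (cos θ x + sin θ z)` are `sin θ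
  -- P_θ ∂_i w`, that is, the gradient of `P_θ w` up to the factor `sin θ / cos θ`.
  simp_rw [stein_mehler hw] at h
  have h2 := mul_le_mul_of_nonneg_left h (sq_nonneg (Real.cos θ))
  refine le_trans (le_of_eq ?_) h2
  simp_rw [pd_mehler hw, Finset.mul_sum]
  exact Finset.sum_congr rfl fun i _ => by ring

lemma mehler_sq_le {w : E n → ℝ} (hw : BddSmooth w) (θ : ℝ) (x : E n) :
    mehler θ w x ^ 2 ≤ mehler θ (fun y => w y ^ 2) x := by
  obtain ⟨C, _, hC⟩ := hw.exists_norm_le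
  have h := sum_sq_integral_coord_mul_le
    (v := fun z => w (Real.cos θ • x + Real.sin θ • z)) (hw.continuous.comp (by fun_prop))
    (fun _ => hC _)
  have h0 : 0 ≤ ∑ i, (∫ z, z i * w (Real.cos θ • x + Real.sin θ • z) ∂(γ n)) ^ 2 :=
    Finset.sum_nonneg fun i _ => sq_nonneg _
  exact sub_nonneg.1 (h0.trans h)

end bessel

/-! ### Consequences of a Poincaré inequality -/

section poincare

variable {n : ℕ} {ν : Measure (E n)} [IsProbabilityMeasure ν] {lam : ℝ}

lemma sum_sq_pd_eq_norm_gradient (g : E n → ℝ) (x : E n) : ∑ i, pd i g x ^ 2 = ‖gradient g x‖ ^ 2 := by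
  rw [norm_sq_eq_sum]; simp_rw [gradient_apply]

lemma Poincare.integral_le (hP : Poincare lam ν) (hlam : 0 ≤ lam) {g : E n → ℝ}
    (hg : BddSmooth g) (h0 : ∫ x, g x ∂ν = 0) :
    lam * ∫ x, g x ^ 2 ∂ν ≤ ∫ x, ∑ i, pd i g x ^ 2 ∂ν := by
  have h := hP g hg.contDiff (hg.integrable ν) h0
  have hi1 : Integrable (fun x => g x ^ 2) ν := (bddSmooth_sq hg).integrable ν
  have hi2 : Integrable (fun x => ∑ i, pd i g x ^ 2) ν :=
    integrable_finsetSum _ fun i _ => (bddSmooth_sq (hg.pd i)).integrable ν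
  have e1 : ∫⁻ x, ‖g x‖ₑ ^ 2 ∂ν = ENNReal.ofReal (∫ x, g x ^ 2 ∂ν) := by
    rw [ofReal_integral_eq_lintegral_ofReal hi1 (Filter.Eventually.of_forall fun x => sq_nonneg _)]
    refine lintegral_congr fun x => ?_
    rw [← ofReal_norm, ← ENNReal.ofReal_pow (norm_nonneg _), Real.norm_eq_abs, sq_abs]
  have e2 : ∫⁻ x, ‖gradient g x‖ₑ ^ 2 ∂ν = ENNReal.ofReal (∫ x, ∑ i, pd i g x ^ 2 ∂ν) := by
    rw [ofReal_integral_eq_lintegral_ofReal hi2 (Filter.Eventually.of_forall fun x =>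
      Finset.sum_nonneg fun i _ => sq_nonneg _)]
    refine lintegral_congr fun x => ?_
    rw [← ofReal_norm, ← ENNReal.ofReal_pow (norm_nonneg _), sum_sq_pd_eq_norm_gradient]
  rw [e1, e2, ← ENNReal.ofReal_mul hlam] at h
  exact (ENNReal.ofReal_le_ofReal_iff (integral_nonneg fun x =>
    Finset.sum_nonneg fun i _ => sq_nonneg _)).1 h

/-- A Poincaré inequality for `ν` bounds the correlation between `ν` and its evolution. -/
lemma Poincare.variance_mehler_le (hP : Poincare lam ν) (hlam : 0 ≤ lam) {w : E n → ℝ}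
    (hw : BddSmooth w) (θ : ℝ) :
    (Real.cos θ ^ 2 + lam * Real.sin θ ^ 2) *
        ∫ x, (mehler θ w x - ∫ y, mehler θ w y ∂ν) ^ 2 ∂ν ≤
      Real.cos θ ^ 2 * ∫ x, mehler θ (fun y => w y ^ 2) x ∂ν := by
  set m := ∫ y, mehler θ w y ∂ν with hm
  have hq := hw.mehler θ
  have hg : BddSmooth fun x => mehler θ w x - m := by
    simpa [sub_eq_add_neg] using hq.add (BddSmooth.const (-m))
  have hpd : ∀ i x, pd i (fun x => mehler θ w x - m) x = pd i (mehler θ w) x := by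
    intro i x; simp [pd, fderiv_sub_const]
  have h1 := hP.integral_le hlam hg (by
    rw [integral_sub (hq.integrable ν) (integrable_const _)]; simp [hm])
  simp_rw [hpd] at h1
  have i1 : Integrable (fun x => ∑ i, pd i (mehler θ w) x ^ 2) ν :=
    integrable_finsetSum _ fun i _ => (bddSmooth_sq (hq.pd i)).integrable ν
  have i2 := ((bddSmooth_sq hw).mehler θ).integrable ν
  have i3 := (bddSmooth_sq hq).integrable ν
  have h2 := integral_mono (i1.const_mul (Real.sin θ ^ 2)) ((i2.sub i3).const_mul (Real.cos θ ^ 2))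
    (sum_sq_pd_mehler_le hw θ)
  simp only [Pi.sub_apply] at h2
  rw [integral_const_mul, integral_const_mul, integral_sub i2 i3] at h2
  have hvar : ∫ x, (mehler θ w x - m) ^ 2 ∂ν = ∫ x, mehler θ w x ^ 2 ∂ν - m ^ 2 := by
    have : ∀ x, (mehler θ w x - m) ^ 2 = mehler θ w x ^ 2 - 2 * m * mehler θ w x + m ^ 2 :=
      fun x => by ring
    simp_rw [this]
    rw [integral_add (by exact i3.sub ((hq.integrable ν).const_mul _)) (integrable_const _),
      integral_sub i3 ((hq.integrable ν).const_mul _), integral_const_mul]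
    simp only [integral_const, probReal_univ, smul_eq_mul, one_mul, ← hm]
    ring
  -- The reverse inequality bounds `sin²θ` times the Dirichlet energy by `cos²θ (∫ P_θ(w²) dν - Var
  -- - m²)`. Moving the variance to the left produces the factor `cos²θ + λ sin²θ`, and `m²` is
  -- discarded.
  have h3 := mul_le_mul_of_nonneg_left h1 (sq_nonneg (Real.sin θ))
  rw [hvar] at h3 ⊢
  nlinarith [mul_nonneg (sq_nonneg (Real.cos θ)) (sq_nonneg m)]

end poincare

/-! ### The Gaussian Poincaré inequality for smooth bounded functions -/

section gaussPoincare

variable {n : ℕ}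

lemma stein_gamma_zero (i : Fin n) (u : E n → ℝ) (hu : BddSmooth u) :
    ∫ x, x i * u x ∂(γ n) = ∫ x, pd i u x ∂(γ n) + 0 := by
  rw [add_zero, stein_gamma hu]

lemma cos_sin_pos {θ : ℝ} (hθ : θ ∈ interior (Set.Icc 0 (Real.pi / 2))) :
    0 < Real.cos θ ∧ 0 < Real.sin θ := by
  rw [interior_Icc] at hθ
  exact ⟨Real.cos_pos_of_mem_Ioo ⟨by linarith [hθ.1, Real.pi_pos], hθ.2⟩,
    Real.sin_pos_of_pos_of_lt_pi hθ.1 (by linarith [hθ.2, Real.pi_pos])⟩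

/-- Invariance of `γ` under `P_θ`, read off from the interpolation with `φ = id`: for `ν = γ` there
is no Stein defect and the derivative is zero. Only one inequality is needed. -/
lemma integral_mehler_mehler_le {h : E n → ℝ} (hh : BddSmooth h) {θ : ℝ}
    (hθ : θ ∈ Set.Icc 0 (Real.pi / 2)) :
    ∫ x, mehler θ (mehler θ h) x ∂(γ n) ≤ ∫ x, h x ∂(γ n) := by
  obtain ⟨C, _, hC⟩ := hh.exists_norm_le
  have hr : ∀ x, h x ∈ Set.Icc (-C) C := fun x => abs_le.1 (hC x)
  have hd := hasDerivAt_interpolation (integrable_norm_gamma n) hh isOpen_univ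
    (φ := id) contDiff_id.contDiffOn (Set.subset_univ _) hr
  have hanti : AntitoneOn (fun θ => ∫ x, mehler θ (fun y => id (mehler θ h y)) x ∂(γ n))
      (Set.Icc 0 (Real.pi / 2)) := by
    refine antitoneOn_of_deriv_nonpos (convex_Icc _ _)
      (fun θ _ => (hd θ).continuousAt.continuousWithinAt)
      (fun θ _ => (hd θ).differentiableAt.differentiableWithinAt) (fun θ hθ => ?_)
    rw [(hd θ).deriv, integral_rotDeriv (integrable_norm_gamma n) hh isOpen_univ
      (φ := id) contDiff_id.contDiffOn (Set.subset_univ _) hr (S := fun _ _ => 0)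
      stein_gamma_zero (cos_sin_pos hθ).1.ne' (e := fun _ _ => 0) (fun _ => continuous_const)
      (fun _ => ⟨0, by simp⟩) (fun i x => by simp)]
    simp [mehler]
  have := hanti (Set.left_mem_Icc.2 (by positivity)) hθ hθ.1
  simpa [mehler_zero] using this

/-- Interpolation with `ν = γ` and `φ(t) = t²`: the derivative is `-2 (sin θ / cos θ) Σ_i ∫ P_θ((∂_i
P_θ h)²) dγ`. Commutation, Jensen and invariance bound it below by the derivative of `-D sin²θ`,
where `D` is the Dirichlet energy of `h`. The endpoints carry `∫ h² dγ` and `(∫ h dγ)²`. -/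
lemma gauss_poincare_bddSmooth {h : E n → ℝ} (hh : BddSmooth h) :
    ∫ x, h x ^ 2 ∂(γ n) ≤ (∫ x, h x ∂(γ n)) ^ 2 + ∫ x, ∑ i, pd i h x ^ 2 ∂(γ n) := by
  obtain ⟨C, _, hC⟩ := hh.exists_norm_le
  have hr : ∀ x, h x ∈ Set.Icc (-C) C := fun x => abs_le.1 (hC x)
  have hφ : ContDiffOn ℝ ∞ (fun t : ℝ => t ^ 2) Set.univ := by fun_prop
  have hd := hasDerivAt_interpolation (integrable_norm_gamma n) hh isOpen_univ
    hφ (Set.subset_univ _) hr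
  set D := ∫ x, ∑ i, pd i h x ^ 2 ∂(γ n) with hD
  have hs : ∀ θ, HasDerivAt (fun θ => D * Real.sin θ ^ 2)
      (D * (2 * Real.sin θ * Real.cos θ)) θ := fun θ => by
    have := ((Real.hasDerivAt_sin θ).pow 2).const_mul D
    refine this.congr_deriv ?_
    ring
  have hd2 := fun θ => (hd θ).add (hs θ)
  have hmono : MonotoneOn (fun θ => (∫ x, mehler θ (fun y => mehler θ h y ^ 2) x ∂(γ n)) +
      D * Real.sin θ ^ 2) (Set.Icc 0 (Real.pi / 2)) := by
    refine monotoneOn_of_deriv_nonneg (convex_Icc _ _)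
      (fun θ _ => (hd2 θ).continuousAt.continuousWithinAt)
      (fun θ _ => (hd2 θ).differentiableAt.differentiableWithinAt) (fun θ hθ => ?_)
    obtain ⟨hc, hs⟩ := cos_sin_pos hθ
    have hpd := fun i => (hh.mehler θ).pd i
    have hd3 : deriv (fun t : ℝ => t ^ 2) = fun t => 2 * t := by ext t; simp
    have hpd1 : ∀ i, pd i (fun y => mehler θ h y ^ 2) =
        fun x => 2 * (mehler θ h x * pd i (mehler θ h) x) := by
      intro i; ext x
      rw [pd_comp (φ := fun t => t ^ 2) isOpen_univ hφ (hh.mehler θ) (Set.mem_univ _), hd3]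
      ring
    have heq := integral_rotDeriv (integrable_norm_gamma n) hh isOpen_univ
      hφ (Set.subset_univ _) hr (S := fun _ _ => 0)
      stein_gamma_zero hc.ne' (e := fun i x => 2 * pd i (mehler θ h) x ^ 2)
      (fun i => ((hpd i).continuous.pow 2).const_mul 2)
      (fun i => by
        obtain ⟨B, _, hB⟩ := (hpd i).exists_norm_le
        refine ⟨2 * B ^ 2, fun x => ?_⟩
        rw [abs_mul, abs_two, abs_pow]
        have : |pd i (mehler θ h) x| ≤ B := hB x
        gcongr)
      (fun i x => by
        rw [hpd1, hd3]
        have e1 : pd i (fun x => 2 * (mehler θ h x * pd i (mehler θ h) x)) x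
            = 2 * pd i (fun x => mehler θ h x * pd i (mehler θ h) x) x := by
          exact pd_const_mul i 2 (((hh.mehler θ).differentiable x).mul ((hpd i).differentiable x))
        rw [e1, pd_mul i ((hh.mehler θ).differentiable x) ((hpd i).differentiable x)]
        ring)
    refine le_of_le_of_eq ?_ (hd2 θ).deriv.symm
    rw [heq]
    simp only [mul_zero, zero_sub]
    have hterm : ∀ i, ∫ x, mehler θ (fun x => 2 * pd i (mehler θ h) x ^ 2) x ∂(γ n) ≤
        2 * Real.cos θ ^ 2 * ∫ x, pd i h x ^ 2 ∂(γ n) := by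
      intro i
      have hsq := bddSmooth_sq (hh.pd i)
      have e1 : (fun x => 2 * pd i (mehler θ h) x ^ 2) =
          fun x => (2 * Real.cos θ ^ 2) * mehler θ (pd i h) x ^ 2 := by
        ext x; rw [pd_mehler hh]; ring
      have e2 : ∀ x, mehler θ (fun x => (2 * Real.cos θ ^ 2) * mehler θ (pd i h) x ^ 2) x =
          (2 * Real.cos θ ^ 2) * mehler θ (fun x => mehler θ (pd i h) x ^ 2) x := fun x =>
        integral_const_mul _ _
      rw [e1]
      simp_rw [e2]
      rw [integral_const_mul]
      refine mul_le_mul_of_nonneg_left ?_ (by positivity)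
      refine le_trans (integral_mono ?_ ?_ fun x => ?_)
        (integral_mehler_mehler_le hsq (interior_subset hθ))
      · exact ((bddSmooth_sq ((hh.pd i).mehler θ)).mehler θ).integrable _
      · exact ((hsq.mehler θ).mehler θ).integrable _
      · exact integral_mono ((bddSmooth_sq ((hh.pd i).mehler θ)).integrable_comp_affine _ _ _ _)
          ((hsq.mehler θ).integrable_comp_affine _ _ _ _) fun z => mehler_sq_le (hh.pd i) θ _
    have hsum : ∑ i, Real.sin θ / Real.cos θ *
        ∫ x, mehler θ (fun x => 2 * pd i (mehler θ h) x ^ 2) x ∂(γ n) ≤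
        D * (2 * Real.sin θ * Real.cos θ) := by
      rw [hD, integral_finsetSum _ fun i _ => (bddSmooth_sq (hh.pd i)).integrable _, Finset.sum_mul]
      refine Finset.sum_le_sum fun i _ => ?_
      refine (mul_le_mul_of_nonneg_left (hterm i) (by positivity)).trans (le_of_eq ?_)
      field_simp
    rw [Finset.sum_neg_distrib]
    linarith
  have := hmono (Set.left_mem_Icc.2 (by positivity)) (Set.right_mem_Icc.2 (by positivity))
    (by positivity : (0 : ℝ) ≤ Real.pi / 2)
  simp only [mehler_zero, Real.sin_zero, mehler_pi_div_two, Real.sin_pi_div_two] at this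
  simpa using this

end gaussPoincare

/-! ### The constant `c` -/

lemma c_lt_one {lam : ℝ} (hlam : 0 < lam) : c lam < 1 := by
  unfold c
  split_ifs with h
  · norm_num
  · have h1 : 0 < (1 - lam) ^ 2 := by have := sub_ne_zero.2 (Ne.symm h); positivity
    rw [div_lt_one h1]
    nlinarith [Real.log_lt_sub_one_of_pos hlam h]

lemma c_pos {lam : ℝ} (hlam : 0 < lam) : 0 < c lam := by
  unfold c
  split_ifs with h
  · norm_num
  · have h1 : 0 < (1 - lam) ^ 2 := by have := sub_ne_zero.2 (Ne.symm h); positivity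
    refine div_pos ?_ h1
    have h2 := Real.log_lt_sub_one_of_pos (inv_pos.2 hlam) (by simpa using h)
    rw [Real.log_inv] at h2
    have h3 := mul_lt_mul_of_pos_left h2 hlam
    rw [mul_sub, mul_inv_cancel₀ hlam.ne'] at h3
    linarith

lemma add_mul_one_sub_pos {lam u : ℝ} (hlam : 0 < lam) (hu : u ∈ Set.Icc (0 : ℝ) 1) :
    0 < u + lam * (1 - u) := by
  rcases hu.1.lt_or_eq with h | h
  · have := mul_nonneg hlam.le (sub_nonneg.2 hu.2); linarith
  · rw [← h]; simpa using hlam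

/-- The origin of the constant: `c(λ) = ∫₀¹ u / (u + λ(1-u)) du`. At `λ = 1` the integrand is `u`,
which explains `c(1) = 1/2`. -/
lemma exists_antiderivative {lam : ℝ} (hlam : 0 < lam) : ∃ b : ℝ → ℝ,
    (∀ u ∈ Set.Icc (0 : ℝ) 1, HasDerivAt b (u / (u + lam * (1 - u))) u) ∧ b 1 - b 0 = c lam := by
  by_cases h : lam = 1
  · refine ⟨fun u => u ^ 2 / 2, fun u hu => ?_, by simp [c, h]⟩
    refine ((hasDerivAt_pow 2 u).div_const 2).congr_deriv ?_
    rw [h]; simp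
  · have hne : 1 - lam ≠ 0 := sub_ne_zero.2 (Ne.symm h)
    refine ⟨fun u => u / (1 - lam) - lam / (1 - lam) ^ 2 * Real.log (u + lam * (1 - u)),
      fun u hu => ?_, ?_⟩
    · have hp := add_mul_one_sub_pos hlam hu
      have h1 : HasDerivAt (fun u => u + lam * (1 - u)) (1 + lam * (-1)) u :=
        (hasDerivAt_id u).add (((hasDerivAt_id u).const_sub 1).const_mul lam)
      have h2 := ((hasDerivAt_id u).div_const (1 - lam)).sub
        ((h1.log hp.ne').const_mul (lam / (1 - lam) ^ 2))
      refine h2.congr_deriv ?_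
      have := hp.ne'
      field_simp
      ring
    · simp only [c, if_neg h]
      simp
      field_simp

/-! ### Densities and their Fisher information -/

section density

variable {n : ℕ} {f : E n → ℝ} {G : E n → E n}

lemma integral_withGaussDensity (hm : Measurable f) (h0 : ∀ x, 0 ≤ f x) (F : E n → ℝ) :
    ∫ x, F x ∂(withGaussDensity f) = ∫ x, f x * F x ∂(γ n) := by
  rw [withGaussDensity, integral_withDensity_eq_integral_toReal_smul hm.ennreal_ofReal
    (Filter.Eventually.of_forall fun x => ENNReal.ofReal_lt_top)]
  simp_rw [ENNReal.toReal_ofReal (h0 _), smul_eq_mul]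

lemma integrable_withGaussDensity (hm : Measurable f) (h0 : ∀ x, 0 ≤ f x) (F : E n → ℝ) :
    Integrable F (withGaussDensity f) ↔ Integrable (fun x => f x * F x) (γ n) := by
  rw [withGaussDensity, integrable_withDensity_iff_integrable_smul' hm.ennreal_ofReal
    (Filter.Eventually.of_forall fun x => ENNReal.ofReal_lt_top)]
  simp_rw [ENNReal.toReal_ofReal (h0 _), smul_eq_mul]

lemma IsWeakGradient.integral_pd (hG : IsWeakGradient f G) (i : Fin n) {φ : E n → ℝ}
    (hφ : ContDiff ℝ ∞ φ) (hc : HasCompactSupport φ) :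
    ∫ x, f x * pd i φ x = - ∫ x, φ x * G x i := by
  have h := congrArg (EuclideanSpace.proj (𝕜 := ℝ) i) (hG.integral_eq φ hφ hc)
  have hgc : Continuous (gradient φ) :=
    (LinearIsometryEquiv.continuous _).comp (hφ.continuous_fderiv (by simp))
  have hgs : HasCompactSupport (gradient φ) :=
    (hc.fderiv (𝕜 := ℝ)).comp_left (g := (InnerProductSpace.toDual ℝ (E n)).symm) (by simp)
  rw [map_neg, ← ContinuousLinearMap.integral_comp_comm _
    (hG.locallyIntegrable.integrable_smul_right_of_hasCompactSupport hgc hgs),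
    ← ContinuousLinearMap.integral_comp_comm _
    (hG.locallyIntegrable_grad.integrable_smul_left_of_hasCompactSupport hφ.continuous hc)] at h
  simpa [gradient_apply] using h

/-- Finite Fisher information in terms of Bochner integrals. -/
lemma fisher_finite (hm : Measurable f) (h0 : ∀ x, 0 ≤ f x) (hfi : Integrable f (γ n))
    (hG : AEStronglyMeasurable G (γ n))
    (hJ : ∫⁻ x, ‖G x‖ₑ ^ 2 / ENNReal.ofReal (f x) ∂(γ n) ≠ ⊤) :
    (∀ᵐ x ∂(γ n), f x = 0 → G x = 0) ∧ Integrable (fun x => ‖G x‖ ^ 2 / f x) (γ n) ∧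
      ∫ x, ‖G x‖ ^ 2 / f x ∂(γ n) =
        (∫⁻ x, ‖G x‖ₑ ^ 2 / ENNReal.ofReal (f x) ∂(γ n)).toReal ∧
      Integrable G (γ n) := by
  have hmeas : AEMeasurable (fun x => ‖G x‖ₑ ^ 2 / ENNReal.ofReal (f x)) (γ n) :=
    (hG.enorm.pow_const 2).div hm.ennreal_ofReal.aemeasurable
  have hz : ∀ᵐ x ∂(γ n), f x = 0 → G x = 0 := by
    filter_upwards [ae_lt_top' hmeas hJ] with x hx hfx
    by_contra hne
    rw [hfx, ENNReal.ofReal_zero, ENNReal.div_zero (by simpa using hne)] at hx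
    exact lt_irrefl _ hx
  have hre : ∀ᵐ x ∂(γ n), ‖G x‖ₑ ^ 2 / ENNReal.ofReal (f x) =
      ENNReal.ofReal (‖G x‖ ^ 2 / f x) := by
    filter_upwards [hz] with x hx
    rcases (h0 x).lt_or_eq with hp | hp
    · rw [ENNReal.ofReal_div_of_pos hp, ENNReal.ofReal_pow (norm_nonneg _), ofReal_norm]
    · rw [hx hp.symm]; simp
  have hmr : AEStronglyMeasurable (fun x => ‖G x‖ ^ 2 / f x) (γ n) :=
    ((hG.norm.aemeasurable.pow_const 2).div hm.aemeasurable).aestronglyMeasurable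
  have hnn : ∀ x, 0 ≤ ‖G x‖ ^ 2 / f x := fun x => div_nonneg (sq_nonneg _) (h0 x)
  have hint : Integrable (fun x => ‖G x‖ ^ 2 / f x) (γ n) := by
    refine ⟨hmr, ?_⟩
    rw [hasFiniteIntegral_iff_ofReal (Filter.Eventually.of_forall hnn), ← lintegral_congr_ae hre]
    exact hJ.lt_top
  refine ⟨hz, hint, ?_, ?_⟩
  · rw [integral_eq_lintegral_of_nonneg_ae (Filter.Eventually.of_forall hnn) hmr,
      lintegral_congr_ae hre]
  · refine (hint.add hfi).mono' hG ?_
    filter_upwards [hz] with x hx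
    simp only [Pi.add_apply]
    rcases (h0 x).lt_or_eq with hp | hp
    -- Integrability of `G` follows from `‖G‖ ≤ ‖G‖²/f + f`, an instance of Young's inequality; on
    -- `{f = 0}` the gradient is zero almost everywhere.
    · rw [div_add' _ _ _ hp.ne', le_div_iff₀ hp]
      nlinarith [sq_nonneg (‖G x‖ - f x), sq_nonneg (‖G x‖), sq_nonneg (f x)]
    · rw [hx hp.symm, ← hp]; simp

end density

/-! ### The dual form of the improved inequality for smooth functions -/

section dual

variable {n : ℕ} {lam : ℝ} {f : E n → ℝ} {G : E n → E n}

/-- For the logarithm, the second-order chain-rule remainder is minus the square of the first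
derivative. This is the favourable term in the interpolation. -/
lemma pd_pd_log {k : E n → ℝ} (hk : BddSmooth k) (hpos : ∀ x, 0 < k x) (i : Fin n) (x : E n) :
    pd i (pd i (fun y => Real.log (k y))) x =
      deriv Real.log (k x) * pd i (pd i k) x + -(pd i (fun y => Real.log (k y)) x) ^ 2 := by
  have hlog : ContDiffOn ℝ ∞ Real.log (Set.Ioi 0) :=
    Real.contDiffOn_log.mono fun x hx => (ne_of_gt hx : x ≠ 0)
  have hinv : ContDiffOn ℝ ∞ (fun t : ℝ => t⁻¹) (Set.Ioi 0) :=
    (contDiffOn_inv ℝ).mono fun x hx => (ne_of_gt hx : x ≠ 0)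
  have h1 : ∀ x, pd i (fun y => Real.log (k y)) x = (k x)⁻¹ * pd i k x := fun x => by
    rw [pd_comp isOpen_Ioi hlog hk (hpos x), Real.deriv_log]
  rw [h1, funext h1, pd_mul (u := fun x => (k x)⁻¹) i ((hk.differentiable x).inv (hpos x).ne')
    ((hk.pd i).differentiable x), pd_comp isOpen_Ioi hinv hk (hpos x), Real.deriv_log]
  simp only [deriv_inv]
  ring

/-- The heart of the proof: the interpolation corrected by `I(ν)` times an antiderivative of the
error weight is nondecreasing, and comparing its endpoints gives the dual inequality. Here the
Fisher integral is that of the given weak gradient `G`. -/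
lemma entropy_dual_bddSmooth (hlam : 0 < lam) (hf : IsCenteredPoincareDensity n lam f)
    (hG : IsWeakGradient f G)
    (hJ : ∫⁻ x, ‖G x‖ₑ ^ 2 / ENNReal.ofReal (f x) ∂(γ n) ≠ ⊤)
    {h : E n → ℝ} (hh : BddSmooth h) {a b : ℝ} (ha : 0 < a) (hr : ∀ x, h x ∈ Set.Icc a b) :
    ∫ x, Real.log (h x) ∂(withGaussDensity f) ≤ Real.log (∫ x, h x ∂(γ n)) +
      c lam / 2 * (∫⁻ x, ‖G x‖ₑ ^ 2 / ENNReal.ofReal (f x) ∂(γ n)).toReal := by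
  have hprob := hf.isProbabilityMeasure
  set ν := withGaussDensity f with hνdef
  have hνint := integral_withGaussDensity hf.measurable hf.nonneg
  have hνi := integrable_withGaussDensity hf.measurable hf.nonneg
  have hfi : Integrable f (γ n) := by
    simpa using (hνi (fun _ => 1)).1 (integrable_const _)
  have hνnorm : Integrable (fun x : E n => ‖x‖) ν := hf.centered.1.norm
  have hxf : Integrable (fun x : E n => ‖x‖ * f x) (γ n) := by
    simpa [mul_comm] using (hνi _).1 hνnorm
  obtain ⟨hz, hJi, hJe, hGi⟩ := fisher_finite hf.measurable hf.nonneg hfi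
    (hG.locallyIntegrable_grad.aestronglyMeasurable.mono_ac (gamma_absolutelyContinuous n)) hJ
  rw [← hJe]
  set J := ∫ x, ‖G x‖ ^ 2 / f x ∂(γ n) with hJdef
  have hGci : ∀ i, Integrable (fun x => G x i) (γ n) := fun i =>
    (EuclideanSpace.proj (𝕜 := ℝ) i).integrable_comp hGi
  set S : Fin n → (E n → ℝ) → ℝ := fun i u => ∫ x, G x i * u x ∂(γ n) with hSdef
  have hS : ∀ i u, BddSmooth u → ∫ x, x i * u x ∂ν = ∫ x, pd i u x ∂ν + S i u := by
    intro i u hu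
    have := integral_by_parts i hfi hxf (hGci i) (fun φ => hG.integral_pd i) hu
    rw [hνint, hνint]
    simp only [hSdef]
    linarith
  -- Integration by parts against the constant `1` identifies this integral with the `i`-th
  -- coordinate of the barycenter of `ν`. Centering is what later allows means to be subtracted.
  have hG0 : ∀ i, ∫ x, G x i ∂(γ n) = 0 := by
    intro i
    have h1 := hS i (fun _ => 1) (BddSmooth.const 1)
    have h2 : ∫ x : E n, x i ∂ν = 0 := by
      have := (EuclideanSpace.proj (𝕜 := ℝ) i).integral_comp_comm hf.centered.1
      rw [hf.centered.2] at this
      simpa using this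
    simpa [hSdef, h2, pd] using h1.symm
  have hlog : ContDiffOn ℝ ∞ Real.log (Set.Ioi 0) :=
    Real.contDiffOn_log.mono fun x hx => (ne_of_gt hx : x ≠ 0)
  have hab : Set.Icc a b ⊆ Set.Ioi 0 := fun x hx => lt_of_lt_of_le ha hx.1
  have hd := hasDerivAt_interpolation hνnorm hh isOpen_Ioi hlog hab hr
  obtain ⟨B, hB, hBc⟩ := exists_antiderivative hlam
  -- The substitution `u = cos²θ` contributes `-2 sin θ cos θ`, hence the factor `-1/2`.
  have hBd : ∀ θ, HasDerivAt (fun θ => J * (-(1 / 2) * B (Real.cos θ ^ 2)))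
      (J * (Real.sin θ * Real.cos θ ^ 3 / (Real.cos θ ^ 2 + lam * Real.sin θ ^ 2))) θ := by
    intro θ
    have h1 := hB (Real.cos θ ^ 2) ⟨sq_nonneg _, Real.cos_sq_le_one θ⟩
    have h2 := ((h1.comp θ ((Real.hasDerivAt_cos θ).pow 2)).const_mul (-(1 / 2))).const_mul J
    refine h2.congr_deriv ?_
    rw [← Real.sin_sq]
    ring
  have hd2 := fun θ => (hd θ).add (hBd θ)
  have hmono : MonotoneOn (fun θ => (∫ x, mehler θ (fun y => Real.log (mehler θ h y)) x ∂ν) +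
      J * (-(1 / 2) * B (Real.cos θ ^ 2))) (Set.Icc 0 (Real.pi / 2)) := by
    refine monotoneOn_of_deriv_nonneg (convex_Icc _ _)
      (fun θ _ => (hd2 θ).continuousAt.continuousWithinAt)
      (fun θ _ => (hd2 θ).differentiableAt.differentiableWithinAt) (fun θ hθ => ?_)
    obtain ⟨hcp, hsp⟩ := cos_sin_pos hθ
    have hk := hh.mehler θ
    have hmem : ∀ x, mehler θ h x ∈ Set.Icc a b := fun x => mehler_mem_Icc hh hr θ x
    set ψ : E n → ℝ := fun y => Real.log (mehler θ h y) with hψdef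
    have hψ : BddSmooth ψ := hk.comp isOpen_Ioi hlog hab hmem
    have heq := integral_rotDeriv hνnorm hh isOpen_Ioi hlog hab hr hS hcp.ne'
      (e := fun i x => -(pd i ψ x) ^ 2) (fun i => ((hψ.pd i).continuous.pow 2).neg)
      (fun i => by
        obtain ⟨D, _, hD⟩ := (hψ.pd i).exists_norm_le
        refine ⟨D ^ 2, fun x => ?_⟩
        rw [abs_neg, abs_pow]
        exact pow_le_pow_left₀ (abs_nonneg _) (hD x) 2)
      (fun i x => pd_pd_log hk (fun x => hab (hmem x)) i x)
    refine le_of_le_of_eq ?_ (hd2 θ).deriv.symm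
    rw [heq]
    set P := Real.cos θ ^ 2 + lam * Real.sin θ ^ 2 with hP
    have hPpos : 0 < P := by positivity
    have hterm : ∀ i, 2 * Real.cos θ * S i (mehler θ (pd i ψ)) ≤
        Real.cos θ ^ 4 / P * ∫ x, (G x i) ^ 2 / f x ∂(γ n) +
          ∫ x, mehler θ (fun y => pd i ψ y ^ 2) x ∂ν := by
      intro i
      have hw := hψ.pd i
      set m := ∫ y, mehler θ (pd i ψ) y ∂ν
      have hg : BddSmooth fun x => mehler θ (pd i ψ) x - m := by
        simpa [sub_eq_add_neg] using (hw.mehler θ).add (BddSmooth.const (-m))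
      obtain ⟨D, _, hD⟩ := hg.exists_norm_le
      have hvar := hf.poincare.variance_mehler_le hlam.le hw θ
      have hi1 : Integrable (fun x => (G x i) ^ 2 / f x) (γ n) := by
        refine hJi.mono' (((hGci i).aestronglyMeasurable.aemeasurable.pow_const 2).div
          hf.measurable.aemeasurable).aestronglyMeasurable (Filter.Eventually.of_forall fun x => ?_)
        rw [Real.norm_of_nonneg (div_nonneg (sq_nonneg _) (hf.nonneg x))]
        refine div_le_div_of_nonneg_right ?_ (hf.nonneg x)
        rw [← sq_abs]
        exact pow_le_pow_left₀ (abs_nonneg _) (abs_apply_le_norm _ i) 2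
      have hi2 : Integrable (fun x => f x * (mehler θ (pd i ψ) x - m) ^ 2) (γ n) :=
        (hνi _).1 ((bddSmooth_sq hg).integrable ν)
      have hi3 : Integrable (fun x => G x i * (mehler θ (pd i ψ) x - m)) (γ n) :=
        (hGci i).mul_bdd hg.continuous.aestronglyMeasurable (Filter.Eventually.of_forall hD)
      have hSm : S i (mehler θ (pd i ψ)) = ∫ x, G x i * (mehler θ (pd i ψ) x - m) ∂(γ n) := by
        have hi4 : Integrable (fun x => G x i * mehler θ (pd i ψ) x) (γ n) := by
          refine (hi3.add ((hGci i).mul_const m)).congr (Filter.Eventually.of_forall fun x => ?_)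
          simp only [Pi.add_apply]; ring
        simp_rw [mul_sub]
        rw [integral_sub hi4 ((hGci i).mul_const m), integral_mul_const, hG0]
        simp [hSdef]
      have hpt : ∀ᵐ x ∂(γ n), 2 * Real.cos θ * (G x i * (mehler θ (pd i ψ) x - m)) ≤
          Real.cos θ ^ 4 / P * ((G x i) ^ 2 / f x) +
            P / Real.cos θ ^ 2 * (f x * (mehler θ (pd i ψ) x - m) ^ 2) := by
        filter_upwards [hz] with x hx
        rcases (hf.nonneg x).lt_or_eq with hp | hp
        -- The weight `P / cos²θ` on the deviation is the reciprocal of the constant in the variance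
        -- bound, so `hvar` turns that term into exactly `∫ P_θ(w²) dν`. This choice forces the
        -- weight `cos⁴θ / P` on the Fisher term.
        · have hsq := sq_nonneg (Real.cos θ ^ 3 * G x i - P * f x * (mehler θ (pd i ψ) x - m))
          have e : Real.cos θ ^ 4 / P * ((G x i) ^ 2 / f x) +
              P / Real.cos θ ^ 2 * (f x * (mehler θ (pd i ψ) x - m) ^ 2) -
              2 * Real.cos θ * (G x i * (mehler θ (pd i ψ) x - m)) =
              (Real.cos θ ^ 3 * G x i - P * f x * (mehler θ (pd i ψ) x - m)) ^ 2 /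
                (P * f x * Real.cos θ ^ 2) := by
            field_simp
            ring
          have : 0 ≤ (Real.cos θ ^ 3 * G x i - P * f x * (mehler θ (pd i ψ) x - m)) ^ 2 /
                (P * f x * Real.cos θ ^ 2) := by positivity
          linarith
        · rw [hx hp.symm, ← hp]; simp
      have hle := integral_mono_ae (hi3.const_mul (2 * Real.cos θ))
        ((hi1.const_mul (Real.cos θ ^ 4 / P)).add (hi2.const_mul (P / Real.cos θ ^ 2))) hpt
      simp only [Pi.add_apply] at hle
      rw [integral_const_mul, integral_add (hi1.const_mul _) (hi2.const_mul _),
        integral_const_mul, integral_const_mul, ← hSm, ← hνint] at hle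
      refine hle.trans (add_le_add le_rfl ?_)
      rw [div_mul_eq_mul_div, div_le_iff₀ (by positivity), mul_comm _ (Real.cos θ ^ 2)]
      exact hvar
    have hJsum : ∑ i, ∫ x, (G x i) ^ 2 / f x ∂(γ n) = J := by
      rw [hJdef, ← integral_finsetSum]
      · congr 1; ext x
        rw [norm_sq_eq_sum, Finset.sum_div]
      · intro i _
        refine hJi.mono' (((hGci i).aestronglyMeasurable.aemeasurable.pow_const 2).div
          hf.measurable.aemeasurable).aestronglyMeasurable (Filter.Eventually.of_forall fun x => ?_)
        rw [Real.norm_of_nonneg (div_nonneg (sq_nonneg _) (hf.nonneg x))]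
        refine div_le_div_of_nonneg_right ?_ (hf.nonneg x)
        rw [← sq_abs]
        exact pow_le_pow_left₀ (abs_nonneg _) (abs_apply_le_norm _ i) 2
    have hneg : ∀ i, ∫ x, mehler θ (fun x => -(pd i ψ x) ^ 2) x ∂ν =
        - ∫ x, mehler θ (fun x => (pd i ψ x) ^ 2) x ∂ν := by
      intro i
      rw [← integral_neg]
      congr 1; ext x
      exact integral_neg _
    have hsum : ∑ i, 2 * Real.cos θ * S i (mehler θ (pd i ψ)) ≤ Real.cos θ ^ 4 / P * J +
        ∑ i, ∫ x, mehler θ (fun y => pd i ψ y ^ 2) x ∂ν := by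
      rw [← hJsum, Finset.mul_sum, ← Finset.sum_add_distrib]
      exact Finset.sum_le_sum fun i _ => hterm i
    have hfin : ∑ i, (-2 * Real.sin θ * S i (mehler θ (pd i ψ)) -
        Real.sin θ / Real.cos θ * ∫ x, mehler θ (fun x => -(pd i ψ x) ^ 2) x ∂ν) =
        Real.sin θ / Real.cos θ * (∑ i, ∫ x, mehler θ (fun y => pd i ψ y ^ 2) x ∂ν -
          ∑ i, 2 * Real.cos θ * S i (mehler θ (pd i ψ))) := by
      rw [← Finset.sum_sub_distrib, Finset.mul_sum]
      refine Finset.sum_congr rfl fun i _ => ?_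
      rw [hneg]
      field_simp
      ring
    rw [hfin]
    have h5 : 0 ≤ Real.sin θ / Real.cos θ * (∑ i, ∫ x, mehler θ (fun y => pd i ψ y ^ 2) x ∂ν -
          ∑ i, 2 * Real.cos θ * S i (mehler θ (pd i ψ)) + Real.cos θ ^ 4 / P * J) :=
      mul_nonneg (by positivity) (by linarith)
    have h6 : Real.sin θ / Real.cos θ * (Real.cos θ ^ 4 / P * J) =
        J * (Real.sin θ * Real.cos θ ^ 3 / P) := by
      field_simp
    rw [mul_add, h6] at h5
    exact h5
  have hfin := hmono (Set.left_mem_Icc.2 (by positivity)) (Set.right_mem_Icc.2 (by positivity))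
    (by positivity : (0 : ℝ) ≤ Real.pi / 2)
  simp only [mehler_zero, mehler_pi_div_two, Real.cos_zero, Real.cos_pi_div_two] at hfin
  simp only [integral_const, probReal_univ, smul_eq_mul, one_mul, one_pow] at hfin
  rw [← hBc]
  norm_num at hfin ⊢
  linarith

end dual

/-! ### From smooth functions to bounded measurable functions -/

section extension

variable {n : ℕ} {ν : Measure (E n)} [IsProbabilityMeasure ν] {K a b : ℝ}

/-- Values in a fixed `[a, b]` with `a > 0` bound both the functions and their logarithms, so
dominated convergence applies on each side. Absolute continuity transfers almost everywhere
convergence from `γ` to `ν`. -/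
lemma dual_of_tendsto (hν : ν ≪ γ n) (ha : 0 < a) {h : E n → ℝ} {hk : ℕ → E n → ℝ}
    (hm : ∀ k, Measurable (hk k)) (hr : ∀ k x, hk k x ∈ Set.Icc a b)
    (hr' : ∀ x, h x ∈ Set.Icc a b)
    (ht : ∀ᵐ x ∂(γ n), Filter.Tendsto (fun k => hk k x) Filter.atTop (nhds (h x)))
    (hle : ∀ k, ∫ x, Real.log (hk k x) ∂ν ≤ Real.log (∫ x, hk k x ∂(γ n)) + K) :
    ∫ x, Real.log (h x) ∂ν ≤ Real.log (∫ x, h x ∂(γ n)) + K := by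
  have hhm : AEStronglyMeasurable h (γ n) :=
    aestronglyMeasurable_of_tendsto_ae Filter.atTop (fun k => (hm k).aestronglyMeasurable) ht
  have hb : ∀ y ∈ Set.Icc a b, ‖y‖ ≤ b := fun y hy => by
    rw [Real.norm_of_nonneg (ha.le.trans hy.1)]; exact hy.2
  have hlb : ∀ y ∈ Set.Icc a b, ‖Real.log y‖ ≤ max |Real.log a| |Real.log b| := fun y hy =>
    abs_le_max_abs_abs (Real.log_le_log ha hy.1) (Real.log_le_log (ha.trans_le hy.1) hy.2)
  have t1 : Filter.Tendsto (fun k => ∫ x, hk k x ∂(γ n)) Filter.atTop (nhds (∫ x, h x ∂(γ n))) :=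
    tendsto_integral_of_dominated_convergence (fun _ => b)
      (fun k => (hm k).aestronglyMeasurable) (integrable_const _)
      (fun k => Filter.Eventually.of_forall fun x => hb _ (hr k x)) ht
  have t2 : Filter.Tendsto (fun k => ∫ x, Real.log (hk k x) ∂ν) Filter.atTop
      (nhds (∫ x, Real.log (h x) ∂ν)) := by
    refine tendsto_integral_of_dominated_convergence (fun _ => max |Real.log a| |Real.log b|)
      (fun k => (Real.measurable_log.comp (hm k)).aestronglyMeasurable) (integrable_const _)
      (fun k => Filter.Eventually.of_forall fun x => hlb _ (hr k x)) ?_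
    filter_upwards [hν.ae_le ht] with x hx
    exact ((Real.continuousAt_log (ha.trans_le (hr' x).1).ne').tendsto).comp hx
  have hpos : 0 < ∫ x, h x ∂(γ n) := by
    refine ha.trans_le ?_
    have := integral_mono (μ := γ n) (integrable_const a)
      (Integrable.of_bound hhm b (Filter.Eventually.of_forall fun x => hb _ (hr' x)))
      (fun x => (hr' x).1)
    simpa using this
  exact le_of_tendsto_of_tendsto' t2
    ((((Real.continuousAt_log hpos.ne').tendsto).comp t1).add_const K) hle

/-- Smooth approximation acts on the compactly supported part only, the constant `a` being kept
apart. An error below `a / 2` keeps the approximants at least `a / 2`. -/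
lemma dual_of_continuous (hν : ν ≪ γ n)
    (hsm : ∀ (h : E n → ℝ) (a b : ℝ), BddSmooth h → 0 < a → (∀ x, h x ∈ Set.Icc a b) →
      ∫ x, Real.log (h x) ∂ν ≤ Real.log (∫ x, h x ∂(γ n)) + K)
    (ha : 0 < a) {v : E n → ℝ} (hv : Continuous v) (hc : HasCompactSupport v)
    (hr : ∀ x, a + v x ∈ Set.Icc a b) :
    ∫ x, Real.log (a + v x) ∂ν ≤ Real.log (∫ x, (a + v x) ∂(γ n)) + K := by
  have hex : ∀ k : ℕ, ∃ g : E n → ℝ, ContDiff ℝ ∞ g ∧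
      (∀ x, dist (g x) (v x) < a / 2 * (1 / ((k : ℝ) + 1))) ∧
      Function.support g ⊆ Function.support v := fun k =>
    hv.exists_contDiff_approx ⊤ continuous_const (fun _ => by positivity)
  choose g hg hgd hgs using hex
  have hle1 : ∀ k : ℕ, 1 / ((k : ℝ) + 1) ≤ 1 := fun k => by
    rw [div_le_one (by positivity)]
    have : (0 : ℝ) ≤ k := Nat.cast_nonneg k
    linarith
  have hb : ∀ k x, a + g k x ∈ Set.Icc (a / 2) (b + a / 2) := by
    intro k x
    have h1 := (hgd k x).le
    rw [Real.dist_eq, abs_le] at h1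
    have h2 := mul_le_mul_of_nonneg_left (hle1 k) (half_pos ha).le
    have h3 := hr x
    constructor <;> linarith [h3.1, h3.2, h1.1, h1.2]
  refine dual_of_tendsto (hk := fun k x => a + g k x) hν (half_pos ha)
    (fun k => (continuous_const.add (hg k).continuous).measurable) hb
    (fun x => ⟨by linarith [(hr x).1], by linarith [(hr x).2]⟩)
    (Filter.Eventually.of_forall fun x => ?_) (fun k => ?_)
  · refine Filter.Tendsto.const_add a (tendsto_iff_dist_tendsto_zero.2 ?_)
    refine squeeze_zero (fun _ => dist_nonneg) (fun k => (hgd k x).le) ?_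
    simpa using (tendsto_one_div_add_atTop_nhds_zero_nat (𝕜 := ℝ)).const_mul (a / 2)
  · have hgc : HasCompactSupport (g k) := hc.mono (hgs k)
    exact hsm _ _ _ ((BddSmooth.const a).add (BddSmooth.of_hasCompactSupport (hg k) hgc))
      (half_pos ha) (hb k)

lemma dual_of_measurable (hν : ν ≪ γ n)
    (hsm : ∀ (h : E n → ℝ) (a b : ℝ), BddSmooth h → 0 < a → (∀ x, h x ∈ Set.Icc a b) →
      ∫ x, Real.log (h x) ∂ν ≤ Real.log (∫ x, h x ∂(γ n)) + K)
    (ha : 0 < a) {h : E n → ℝ} (hh : Measurable h) (hr : ∀ x, h x ∈ Set.Icc a b) :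
    ∫ x, Real.log (h x) ∂ν ≤ Real.log (∫ x, h x ∂(γ n)) + K := by
  have hab : a ≤ b := (hr 0).1.trans (hr 0).2
  have hwi : Integrable (fun x => h x - a) (γ n) := by
    refine Integrable.of_bound (hh.sub_const a).aestronglyMeasurable (b - a)
      (Filter.Eventually.of_forall fun x => ?_)
    rw [Real.norm_of_nonneg (sub_nonneg.2 (hr x).1)]
    linarith [(hr x).2]
  have hex : ∀ k : ℕ, ∃ g : E n → ℝ, HasCompactSupport g ∧
      ∫⁻ x, ‖(h x - a) - g x‖ₑ ∂(γ n) ≤ ENNReal.ofReal (1 / ((k : ℝ) + 1)) ∧ Continuous g ∧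
      Integrable g (γ n) := fun k =>
    hwi.exists_hasCompactSupport_lintegral_sub_le (by
      simp only [ne_eq, ENNReal.ofReal_eq_zero, not_le]; positivity)
  choose g hgc hgl hgcont hgi using hex
  have htm : TendstoInMeasure (γ n) g Filter.atTop (fun x => h x - a) := by
    refine tendstoInMeasure_of_tendsto_eLpNorm (p := 1) one_ne_zero
      (fun k => (hgi k).aestronglyMeasurable) hwi.aestronglyMeasurable ?_
    refine tendsto_of_tendsto_of_tendsto_of_le_of_le tendsto_const_nhds
      (h := fun k : ℕ => ENNReal.ofReal (1 / ((k : ℝ) + 1))) ?_ (fun _ => zero_le)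
      (fun k => ?_)
    · simpa [Function.comp_def] using (ENNReal.continuous_ofReal.tendsto 0).comp
        (tendsto_one_div_add_atTop_nhds_zero_nat (𝕜 := ℝ))
    · rw [eLpNorm_sub_comm, eLpNorm_one_eq_lintegral_enorm]
      exact hgl k
  obtain ⟨ns, _, hns⟩ := htm.exists_seq_tendsto_ae
  -- Approximation in `L¹` does not respect the range, so the approximants are clamped. The clamp
  -- fixes `0`, preserving compact support, and fixes the values of the limit.
  have hcl : ∀ y : ℝ, a + max 0 (min (b - a) y) ∈ Set.Icc a b := fun y =>
    ⟨by linarith [le_max_left 0 (min (b - a) y)], by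
      have : max 0 (min (b - a) y) ≤ b - a := max_le (sub_nonneg.2 hab) (min_le_left _ _)
      linarith⟩
  refine dual_of_tendsto (hk := fun k x => a + max 0 (min (b - a) (g (ns k) x))) hν ha
    (fun k => by have := (hgcont (ns k)).measurable; fun_prop) (fun k x => hcl _) hr ?_
    (fun k => ?_)
  · filter_upwards [hns] with x hx
    have hcont : Continuous fun y : ℝ => a + max 0 (min (b - a) y) := by fun_prop
    have h1 := (hcont.tendsto (h x - a)).comp hx
    have h2 : a + max 0 (min (b - a) (h x - a)) = h x := by
      rw [min_eq_right (by linarith [(hr x).2]), max_eq_right (by linarith [(hr x).1])]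
      ring
    rw [h2] at h1
    exact h1
  · refine dual_of_continuous hν hsm ha (v := fun x => max 0 (min (b - a) (g (ns k) x)))
      (by have := hgcont (ns k); fun_prop) ?_ (fun x => hcl _)
    exact (hgc (ns k)).comp_left (g := fun y => max 0 (min (b - a) y))
      (by rw [min_eq_right (sub_nonneg.2 hab), max_self])

end extension

/-! ### From the dual form to the entropy -/

section entropy

variable {n : ℕ} {f : E n → ℝ} {K : ℝ}

/-- The uniform lower bound that lets Fatou's lemma be applied to the truncated entropies; for `t ≤
1` it comes from `t log t ≥ t - 1`. -/
lemma neg_one_le_mul_log {t w : ℝ} (ht : 0 ≤ t) (hw : min t 1 ≤ w) : -1 ≤ t * Real.log w := by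
  rcases ht.lt_or_eq with h | h
  · rcases le_total 1 t with h1 | h1
    · rw [min_eq_right h1] at hw
      have := mul_nonneg ht (Real.log_nonneg hw)
      linarith
    · rw [min_eq_left h1] at hw
      have h2 := mul_le_mul_of_nonneg_left (Real.log_le_log h hw) ht
      have h3 := mul_le_mul_of_nonneg_left (Real.one_sub_inv_le_log_of_pos h) ht
      rw [mul_sub, mul_inv_cancel₀ h.ne'] at h3
      linarith
  · rw [← h]; simp

/-- The optimal test function in the dual problem is `f` itself. Truncating it to `[1/(k+1), k+1]`
makes it admissible and raises its `γ`-mean to at most `1 + 1/(k+1)`, so the logarithmic term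
vanishes in the limit. Fatou then yields both integrability and the bound. -/
lemma entropy_le_of_dual (hm : Measurable f) (h0 : ∀ x, 0 ≤ f x)
    (hp : IsProbabilityMeasure (withGaussDensity f)) (hK : 0 ≤ K)
    (hdual : ∀ (h : E n → ℝ) (a b : ℝ), Measurable h → 0 < a → (∀ x, h x ∈ Set.Icc a b) →
      ∫ x, Real.log (h x) ∂(withGaussDensity f) ≤ Real.log (∫ x, h x ∂(γ n)) + K) :
    Integrable (fun x => f x * Real.log (f x)) (γ n) ∧ entropy f ≤ K := by
  have hfi : Integrable f (γ n) := by
    simpa using (integrable_withGaussDensity hm h0 (fun _ => 1)).1 (integrable_const _)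
  have hf1 : ∫ x, f x ∂(γ n) = 1 := by
    have := integral_withGaussDensity hm h0 (fun _ => 1)
    simpa using this.symm
  let w : ℕ → E n → ℝ := fun k x => max (1 / ((k : ℝ) + 1)) (min (f x) ((k : ℝ) + 1))
  have hε : ∀ k : ℕ, 0 < 1 / ((k : ℝ) + 1) := fun k => by positivity
  have hε1 : ∀ k : ℕ, 1 / ((k : ℝ) + 1) ≤ (k : ℝ) + 1 := fun k => by
    have h0 : (0 : ℝ) ≤ k := Nat.cast_nonneg k
    rw [div_le_iff₀ (by positivity)]; nlinarith
  have hwm : ∀ k, Measurable (w k) := fun k => by fun_prop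
  have hwr : ∀ (k : ℕ) (x : E n), w k x ∈ Set.Icc (1 / ((k : ℝ) + 1)) ((k : ℝ) + 1) := fun k x =>
    ⟨le_max_left _ _, max_le (hε1 k) (min_le_right _ _)⟩
  have hwf : ∀ (k : ℕ) (x : E n), w k x ≤ f x + 1 / ((k : ℝ) + 1) := fun k x =>
    max_le (by linarith [h0 x]) ((min_le_left _ _).trans (by linarith [hε k]))
  have hwmin : ∀ k x, min (f x) 1 ≤ w k x := fun k x => by
    refine le_trans ?_ (le_max_right _ _)
    have h0 : (0 : ℝ) ≤ k := Nat.cast_nonneg k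
    exact min_le_min le_rfl (by linarith)
  have hlogb : ∀ (k : ℕ) (x : E n), ‖Real.log (w k x)‖ ≤
      max |Real.log (1 / ((k : ℝ) + 1))| |Real.log ((k : ℝ) + 1)| := fun k x =>
    abs_le_max_abs_abs (Real.log_le_log (hε k) (hwr k x).1)
      (Real.log_le_log ((hε k).trans_le (hwr k x).1) (hwr k x).2)
  have hli : ∀ k, Integrable (fun x => f x * Real.log (w k x)) (γ n) := fun k =>
    hfi.mul_bdd (Real.measurable_log.comp (hwm k)).aestronglyMeasurable
      (Filter.Eventually.of_forall (hlogb k))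
  have hlint : ∀ k : ℕ, ∫ x, f x * Real.log (w k x) ∂(γ n) ≤ 1 / ((k : ℝ) + 1) + K := by
    intro k
    have h1 := hdual (w k) _ _ (hwm k) (hε k) (hwr k)
    rw [integral_withGaussDensity hm h0] at h1
    have hwi : Integrable (w k) (γ n) := by
      refine Integrable.of_bound (hwm k).aestronglyMeasurable ((k : ℝ) + 1)
        (Filter.Eventually.of_forall fun x => ?_)
      rw [Real.norm_of_nonneg ((hε k).le.trans (hwr k x).1)]
      exact (hwr k x).2
    have h2 : ∫ x, w k x ∂(γ n) ≤ 1 + 1 / ((k : ℝ) + 1) := by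
      have := integral_mono hwi (hfi.add (integrable_const _)) (hwf k)
      simp only [Pi.add_apply] at this
      rw [integral_add hfi (integrable_const _), hf1] at this
      simpa using this
    have h3 : 0 < ∫ x, w k x ∂(γ n) := by
      refine (hε k).trans_le ?_
      have := integral_mono (integrable_const _) hwi fun x => (hwr k x).1
      simpa using this
    have h4 := Real.log_le_sub_one_of_pos h3
    linarith
  have hnn : ∀ k x, 0 ≤ f x * Real.log (w k x) + 1 := fun k x => by
    linarith [neg_one_le_mul_log (h0 x) (hwmin k x)]
  have hnn' : ∀ x, 0 ≤ f x * Real.log (f x) + 1 := fun x => by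
    linarith [neg_one_le_mul_log (h0 x) (min_le_left (f x) 1)]
  have hmeas : Measurable fun x => f x * Real.log (f x) + 1 :=
    (hm.mul (Real.measurable_log.comp hm)).add_const 1
  have hlim : ∀ x, Filter.Tendsto (fun k => ENNReal.ofReal (f x * Real.log (w k x) + 1))
      Filter.atTop (nhds (ENNReal.ofReal (f x * Real.log (f x) + 1))) := by
    intro x
    refine (ENNReal.continuous_ofReal.tendsto _).comp (Filter.Tendsto.add_const _ ?_)
    rcases (h0 x).lt_or_eq with hp | hp
    · refine (((Real.continuousAt_log hp.ne').tendsto).comp ?_).const_mul (f x)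
      apply tendsto_const_nhds.congr'
      have e1 := (tendsto_one_div_add_atTop_nhds_zero_nat (𝕜 := ℝ)).eventually (gt_mem_nhds hp)
      have e2 : ∀ᶠ k : ℕ in Filter.atTop, f x < (k : ℝ) :=
        tendsto_natCast_atTop_atTop.eventually (Filter.eventually_gt_atTop (f x))
      filter_upwards [e1, e2] with k h1 h2
      simp only [w]
      rw [min_eq_left (by linarith), max_eq_right h1.le]
    · rw [← hp]; simp
  have hF : ∫⁻ x, ENNReal.ofReal (f x * Real.log (f x) + 1) ∂(γ n) ≤ ENNReal.ofReal (K + 1) := by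
    calc ∫⁻ x, ENNReal.ofReal (f x * Real.log (f x) + 1) ∂(γ n)
        = ∫⁻ x, Filter.liminf (fun k => ENNReal.ofReal (f x * Real.log (w k x) + 1))
            Filter.atTop ∂(γ n) := lintegral_congr fun x => (hlim x).liminf_eq.symm
      _ ≤ Filter.liminf (fun k => ∫⁻ x, ENNReal.ofReal (f x * Real.log (w k x) + 1) ∂(γ n))
            Filter.atTop := lintegral_liminf_le fun k =>
          ((hm.mul (Real.measurable_log.comp (hwm k))).add_const 1).ennreal_ofReal
      _ ≤ Filter.liminf (fun k : ℕ => ENNReal.ofReal (1 / ((k : ℝ) + 1) + (K + 1)))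
            Filter.atTop := by
          refine Filter.liminf_le_liminf (Filter.Eventually.of_forall fun k => ?_)
          rw [← ofReal_integral_eq_lintegral_ofReal (by exact (hli k).add (integrable_const _))
            (Filter.Eventually.of_forall (hnn k)), integral_add (hli k) (integrable_const _)]
          refine ENNReal.ofReal_le_ofReal ?_
          simp only [integral_const, probReal_univ, smul_eq_mul, one_mul]
          linarith [hlint k]
      _ = ENNReal.ofReal (K + 1) := by
          refine Filter.Tendsto.liminf_eq ((ENNReal.continuous_ofReal.tendsto _).comp ?_)
          simpa using (tendsto_one_div_add_atTop_nhds_zero_nat (𝕜 := ℝ)).add_const (K + 1)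
  have hint1 : Integrable (fun x => f x * Real.log (f x) + 1) (γ n) := by
    refine ⟨hmeas.aestronglyMeasurable, ?_⟩
    rw [hasFiniteIntegral_iff_ofReal (Filter.Eventually.of_forall hnn')]
    exact hF.trans_lt ENNReal.ofReal_lt_top
  have hint : Integrable (fun x => f x * Real.log (f x)) (γ n) :=
    (hint1.sub (integrable_const 1)).congr (Filter.Eventually.of_forall fun x => by simp)
  refine ⟨hint, ?_⟩
  rw [← ofReal_integral_eq_lintegral_ofReal hint1 (Filter.Eventually.of_forall hnn'),
    ENNReal.ofReal_le_ofReal_iff (by linarith), integral_add hint (integrable_const _)] at hF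
  simpa [entropy] using hF

/-- The improved logarithmic Sobolev inequality. -/
theorem entropy_le {lam : ℝ} (hlam : 0 < lam) (hf : IsCenteredPoincareDensity n lam f)
    (hI : fisherInfo f ≠ ⊤) :
    Integrable (fun x => f x * Real.log (f x)) (γ n) ∧
      entropy f ≤ c lam / 2 * (fisherInfo f).toReal := by
  have hprob := hf.isProbabilityMeasure
  have hc := c_pos hlam
  have hone : ∀ G : E n → E n, IsWeakGradient f G →
      ∫⁻ x, ‖G x‖ₑ ^ 2 / ENNReal.ofReal (f x) ∂(γ n) ≠ ⊤ →
      Integrable (fun x => f x * Real.log (f x)) (γ n) ∧ entropy f ≤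
        c lam / 2 * (∫⁻ x, ‖G x‖ₑ ^ 2 / ENNReal.ofReal (f x) ∂(γ n)).toReal := by
    intro G hG hJ
    refine entropy_le_of_dual hf.measurable hf.nonneg hprob
      (mul_nonneg (by positivity) ENNReal.toReal_nonneg) ?_
    intro h a b hh ha hr
    exact dual_of_measurable (ν := withGaussDensity f) (withDensity_absolutelyContinuous _ _)
      (fun h a b hh ha hr => entropy_dual_bddSmooth hlam hf hG hJ hh ha hr) ha hh hr
  obtain ⟨G, hG, hJ⟩ : ∃ G : E n → E n, IsWeakGradient f G ∧
      ∫⁻ x, ‖G x‖ₑ ^ 2 / ENNReal.ofReal (f x) ∂(γ n) ≠ ⊤ := by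
    by_contra hcon
    push Not at hcon
    exact hI (by simpa [fisherInfo] using hcon)
  refine ⟨(hone G hG hJ).1, ?_⟩
  -- Since `fisherInfo` is an infimum over weak gradients, the estimate is turned into a lower bound
  -- on every competitor, with no appeal to uniqueness of the weak gradient.
  have hle : ENNReal.ofReal (2 / c lam * entropy f) ≤ fisherInfo f := by
    refine le_iInf₂ fun G hG => ?_
    by_cases hJ : ∫⁻ x, ‖G x‖ₑ ^ 2 / ENNReal.ofReal (f x) ∂(γ n) = ⊤
    · rw [hJ]; exact le_top
    · refine ENNReal.ofReal_le_of_le_toReal ?_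
      have h1 := mul_le_mul_of_nonneg_left (hone G hG hJ).2 (by positivity : 0 ≤ 2 / c lam)
      refine h1.trans (le_of_eq ?_)
      field_simp
  have h2 := mul_le_mul_of_nonneg_left ((ENNReal.ofReal_le_iff_le_toReal hI).1 hle)
    (by positivity : 0 ≤ c lam / 2)
  refine le_trans (le_of_eq ?_) h2
  field_simp

end entropy

/-! ### The Gaussian Poincaré inequality for smooth functions -/

section gaussPoincare

variable {n : ℕ}

lemma sum_sq_pd_eq_norm_fderiv (g : E n → ℝ) (x : E n) : ∑ i, pd i g x ^ 2 = ‖fderiv ℝ g x‖ ^ 2 := by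
  rw [sum_sq_pd_eq_norm_gradient, norm_gradient]

/-- Removes the boundedness of derivatives: the inequality is applied to `χ_k u` and passes to the
limit, since the cutoff gradients are bounded and tend to zero. -/
lemma gauss_poincare_bounded {u : E n → ℝ} (hu : ContDiff ℝ ∞ u) {A : ℝ} (hA : ∀ x, |u x| ≤ A)
    (hD : Integrable (fun x => ‖fderiv ℝ u x‖ ^ 2) (γ n)) :
    ∫ x, u x ^ 2 ∂(γ n) ≤ (∫ x, u x ∂(γ n)) ^ 2 + ∫ x, ‖fderiv ℝ u x‖ ^ 2 ∂(γ n) := by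
  obtain ⟨χ, C, hC0, hχs, hχc, hχ0, hχ1, hχt, hχd⟩ := exists_smooth_cutoff n
  have hA0 : 0 ≤ A := (abs_nonneg _).trans (hA 0)
  have hχabs : ∀ k x, |χ k x| ≤ 1 := fun k x => by rw [abs_of_nonneg (hχ0 k x)]; exact hχ1 k x
  have hχdiff : ∀ k, Differentiable ℝ (χ k) := fun k => (hχs k).differentiable (by simp)
  have hudiff : Differentiable ℝ u := hu.differentiable (by simp)
  have hχd' : ∀ k x, ‖fderiv ℝ (χ k) x‖ ≤ C := fun k x => by
    refine (hχd k x).trans (mul_le_of_le_one_right hC0 ?_)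
    rw [div_le_one (by positivity)]
    have : (0 : ℝ) ≤ k := Nat.cast_nonneg k
    linarith
  have hχpdt : ∀ i x, Filter.Tendsto (fun k => pd i (χ k) x) Filter.atTop (nhds 0) := fun i x => by
    refine squeeze_zero_norm (fun k => (abs_pd_le i).trans (hχd k x)) ?_
    simpa using (tendsto_one_div_add_atTop_nhds_zero_nat (𝕜 := ℝ)).const_mul C
  have hb : ∀ k, BddSmooth fun x => χ k x * u x := fun k =>
    BddSmooth.of_hasCompactSupport ((hχs k).mul hu) ((hχc k).mul_right)
  have hle := fun k => gauss_poincare_bddSmooth (hb k)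
  have hbd : ∀ k x, ‖χ k x * u x‖ ≤ A := fun k x => by
    rw [norm_mul]
    exact (mul_le_mul (hχabs k x) (hA x) (abs_nonneg _) zero_le_one).trans (one_mul A).le
  have t1 : Filter.Tendsto (fun k => ∫ x, (χ k x * u x) ^ 2 ∂(γ n)) Filter.atTop
      (nhds (∫ x, (1 * u x) ^ 2 ∂(γ n))) :=
    tendsto_integral_of_dominated_convergence (fun _ => A ^ 2)
      (fun k => ((hb k).continuous.pow 2).aestronglyMeasurable) (integrable_const _)
      (fun k => Filter.Eventually.of_forall fun x => by
        rw [norm_pow]; exact pow_le_pow_left₀ (norm_nonneg _) (hbd k x) 2)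
      (Filter.Eventually.of_forall fun x => ((hχt x).mul_const _).pow 2)
  have t2 : Filter.Tendsto (fun k => ∫ x, χ k x * u x ∂(γ n)) Filter.atTop
      (nhds (∫ x, 1 * u x ∂(γ n))) :=
    tendsto_integral_of_dominated_convergence (fun _ => A)
      (fun k => (hb k).continuous.aestronglyMeasurable) (integrable_const _)
      (fun k => Filter.Eventually.of_forall (hbd k))
      (Filter.Eventually.of_forall fun x => (hχt x).mul_const _)
  have t3 : Filter.Tendsto (fun k => ∫ x, ∑ i, pd i (fun x => χ k x * u x) x ^ 2 ∂(γ n))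
      Filter.atTop (nhds (∫ x, ∑ i, pd i u x ^ 2 ∂(γ n))) := by
    refine tendsto_integral_of_dominated_convergence
      (fun x => 2 * ‖fderiv ℝ u x‖ ^ 2 + 2 * (A * C) ^ 2)
      (fun k => Continuous.aestronglyMeasurable
        (continuous_finsetSum _ fun i _ => ((hb k).pd i).continuous.pow 2))
      ((hD.const_mul 2).add (integrable_const _)) (fun k => ?_) ?_
    · refine Filter.Eventually.of_forall fun x => ?_
      rw [sum_sq_pd_eq_norm_fderiv, norm_pow, norm_norm, fderiv_fun_mul (hχdiff k x) (hudiff x)]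
      have h1 : ‖χ k x • fderiv ℝ u x + u x • fderiv ℝ (χ k) x‖ ≤ ‖fderiv ℝ u x‖ + A * C := by
        refine (norm_add_le _ _).trans (add_le_add ?_ ?_)
        · rw [norm_smul]; exact mul_le_of_le_one_left (norm_nonneg _) (hχabs k x)
        · rw [norm_smul]; exact mul_le_mul (hA x) (hχd' k x) (norm_nonneg _) hA0
      refine (pow_le_pow_left₀ (norm_nonneg _) h1 2).trans ?_
      nlinarith [sq_nonneg (‖fderiv ℝ u x‖ - A * C)]
    · refine Filter.Eventually.of_forall fun x => ?_
      refine tendsto_finsetSum _ fun i _ => Filter.Tendsto.pow ?_ 2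
      have : ∀ k, pd i (fun x => χ k x * u x) x = χ k x * pd i u x + u x * pd i (χ k) x := fun k =>
        pd_mul i (hχdiff k x) (hudiff x)
      simp_rw [this]
      simpa using ((hχt x).mul_const (pd i u x)).add ((hχpdt i x).const_mul (u x))
  have := le_of_tendsto_of_tendsto' t1 ((t2.pow 2).add t3) hle
  simpa [sum_sq_pd_eq_norm_fderiv] using this

lemma abs_arctan_le (y : ℝ) : |Real.arctan y| ≤ |y| := by
  have := Convex.norm_image_sub_le_of_norm_deriv_le (f := Real.arctan) (C := 1) (s := Set.univ)
    (x := 0) (y := y) (fun x _ => Real.differentiableAt_arctan x) (fun x _ => by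
      rw [Real.deriv_arctan, Real.norm_of_nonneg (by positivity), div_le_one (by positivity)]
      nlinarith [sq_nonneg x]) convex_univ (Set.mem_univ _) (Set.mem_univ _)
  simpa using this

lemma tendsto_mul_arctan (y : ℝ) : Filter.Tendsto
    (fun k : ℕ => ((k : ℝ) + 1) * Real.arctan (1 / ((k : ℝ) + 1) * y)) Filter.atTop (nhds y) := by
  have h1 : HasDerivAt (fun t : ℝ => Real.arctan (t * y)) (1 / (1 + (0 * y) ^ 2) * (1 * y)) 0 :=
    ((hasDerivAt_id (0 : ℝ)).mul_const y).arctan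
  have h2 := h1.tendsto_slope_zero_right
  have h3 : Filter.Tendsto (fun k : ℕ => 1 / ((k : ℝ) + 1)) Filter.atTop
      (nhdsWithin 0 (Set.Ioi 0)) := tendsto_nhdsWithin_iff.2
    ⟨tendsto_one_div_add_atTop_nhds_zero_nat, Filter.Eventually.of_forall fun k => by
      simp only [Set.mem_Ioi]; positivity⟩
  have h4 := h2.comp h3
  simpa [Function.comp_def] using h4

/-- Square integrability of `g` is not known in advance, so `g` is replaced by `(k+1)
arctan(g/(k+1))`: smooth, bounded, no larger than `|g|`, and with no larger gradient. Integrability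
of `g` sends the means to zero and Fatou handles the squares. If the energy is infinite there is
nothing to prove. -/
lemma gauss_poincare {g : E n → ℝ} (hg : ContDiff ℝ ∞ g) (hgi : Integrable g (γ n))
    (h0 : ∫ x, g x ∂(γ n) = 0) :
    ∫⁻ x, ‖g x‖ₑ ^ 2 ∂(γ n) ≤ ∫⁻ x, ‖fderiv ℝ g x‖ₑ ^ 2 ∂(γ n) := by
  by_cases htop : ∫⁻ x, ‖fderiv ℝ g x‖ₑ ^ 2 ∂(γ n) = ⊤
  · rw [htop]; exact le_top
  have hgd : Differentiable ℝ g := hg.differentiable (by simp)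
  have hfc : Continuous (fderiv ℝ g) := hg.continuous_fderiv (by simp)
  have he : ∀ x, ‖fderiv ℝ g x‖ₑ ^ 2 = ENNReal.ofReal (‖fderiv ℝ g x‖ ^ 2) := fun x => by
    rw [ENNReal.ofReal_pow (norm_nonneg _), ofReal_norm]
  have he' : ∀ x, ‖g x‖ₑ ^ 2 = ENNReal.ofReal (g x ^ 2) := fun x => by
    rw [← sq_abs, ENNReal.ofReal_pow (abs_nonneg _), ← Real.norm_eq_abs, ofReal_norm]
  simp_rw [he] at htop ⊢
  simp_rw [he']
  have hD : Integrable (fun x => ‖fderiv ℝ g x‖ ^ 2) (γ n) := by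
    refine ⟨(hfc.norm.pow 2).aestronglyMeasurable, ?_⟩
    rw [hasFiniteIntegral_iff_ofReal (Filter.Eventually.of_forall fun x => sq_nonneg _)]
    exact lt_top_iff_ne_top.2 htop
  rw [← ofReal_integral_eq_lintegral_ofReal hD (Filter.Eventually.of_forall fun x => sq_nonneg _)]
  set D := ∫ x, ‖fderiv ℝ g x‖ ^ 2 ∂(γ n)
  let u : ℕ → E n → ℝ := fun k x => ((k : ℝ) + 1) * Real.arctan (1 / ((k : ℝ) + 1) * g x)
  have hpos : ∀ k : ℕ, (0 : ℝ) < (k : ℝ) + 1 := fun k => by positivity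
  have hus : ∀ k, ContDiff ℝ ∞ (u k) := fun k =>
    contDiff_const.mul (Real.contDiff_arctan.comp (contDiff_const.mul hg))
  have hub : ∀ k x, |u k x| ≤ ((k : ℝ) + 1) * (Real.pi / 2) := fun k x => by
    rw [abs_mul, abs_of_pos (hpos k)]
    refine mul_le_mul_of_nonneg_left (abs_le.2 ⟨?_, ?_⟩) (hpos k).le
    · exact (Real.neg_pi_div_two_lt_arctan _).le
    · exact (Real.arctan_lt_pi_div_two _).le
  have hug : ∀ k x, |u k x| ≤ |g x| := fun k x => by
    rw [abs_mul, abs_of_pos (hpos k)]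
    refine (mul_le_mul_of_nonneg_left (abs_arctan_le _) (hpos k).le).trans (le_of_eq ?_)
    rw [abs_mul, abs_of_pos (one_div_pos.2 (hpos k)), ← mul_assoc,
      mul_one_div_cancel (hpos k).ne', one_mul]
  have hud : ∀ k x, ‖fderiv ℝ (u k) x‖ ≤ ‖fderiv ℝ g x‖ := fun k x => by
    have h1 := (((hgd x).hasFDerivAt.const_mul (1 / ((k : ℝ) + 1))).arctan).const_mul ((k : ℝ) + 1)
    have h2 : HasFDerivAt (u k) _ x := h1
    rw [h2.fderiv, norm_smul, norm_smul, norm_smul, Real.norm_of_nonneg (hpos k).le,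
      Real.norm_of_nonneg (by positivity), Real.norm_of_nonneg (one_div_pos.2 (hpos k)).le]
    have h3 : 1 / (1 + (1 / ((k : ℝ) + 1) * g x) ^ 2) ≤ 1 := by
      rw [div_le_one (by positivity)]
      linarith [sq_nonneg (1 / ((k : ℝ) + 1) * g x)]
    calc ((k : ℝ) + 1) * (1 / (1 + (1 / ((k : ℝ) + 1) * g x) ^ 2) *
          (1 / ((k : ℝ) + 1) * ‖fderiv ℝ g x‖))
        = 1 / (1 + (1 / ((k : ℝ) + 1) * g x) ^ 2) * ‖fderiv ℝ g x‖ := by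
          have := (hpos k).ne'
          field_simp
      _ ≤ 1 * ‖fderiv ℝ g x‖ := by gcongr
      _ = _ := one_mul _
  have hudi : ∀ k, Integrable (fun x => ‖fderiv ℝ (u k) x‖ ^ 2) (γ n) := fun k =>
    hD.mono' ((((hus k).continuous_fderiv (by simp)).norm.pow 2).aestronglyMeasurable)
      (Filter.Eventually.of_forall fun x => by
        rw [norm_pow, norm_norm]; exact pow_le_pow_left₀ (norm_nonneg _) (hud k x) 2)
  have hk : ∀ k, ∫ x, u k x ^ 2 ∂(γ n) ≤ (∫ x, u k x ∂(γ n)) ^ 2 + D := fun k =>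
    (gauss_poincare_bounded (hus k) (hub k) (hudi k)).trans (add_le_add le_rfl
      (integral_mono (hudi k) hD fun x => pow_le_pow_left₀ (norm_nonneg _) (hud k x) 2))
  have hmean : Filter.Tendsto (fun k => ∫ x, u k x ∂(γ n)) Filter.atTop (nhds 0) := by
    rw [← h0]
    exact tendsto_integral_of_dominated_convergence (fun x => |g x|)
      (fun k => (hus k).continuous.aestronglyMeasurable) hgi.abs
      (fun k => Filter.Eventually.of_forall (hug k))
      (Filter.Eventually.of_forall fun x => tendsto_mul_arctan (g x))
  have hu2 : ∀ k, Integrable (fun x => u k x ^ 2) (γ n) := fun k =>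
    Integrable.of_bound (((hus k).continuous.pow 2).aestronglyMeasurable)
      ((((k : ℝ) + 1) * (Real.pi / 2)) ^ 2) (Filter.Eventually.of_forall fun x => by
        rw [norm_pow]; exact pow_le_pow_left₀ (norm_nonneg _) (hub k x) 2)
  calc ∫⁻ x, ENNReal.ofReal (g x ^ 2) ∂(γ n)
      = ∫⁻ x, Filter.liminf (fun k => ENNReal.ofReal (u k x ^ 2)) Filter.atTop ∂(γ n) :=
        lintegral_congr fun x => (((ENNReal.continuous_ofReal.tendsto _).comp
          ((tendsto_mul_arctan (g x)).pow 2)).liminf_eq).symm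
    _ ≤ Filter.liminf (fun k => ∫⁻ x, ENNReal.ofReal (u k x ^ 2) ∂(γ n)) Filter.atTop :=
        lintegral_liminf_le fun k => ((hus k).continuous.pow 2).measurable.ennreal_ofReal
    _ ≤ Filter.liminf (fun k => ENNReal.ofReal ((∫ x, u k x ∂(γ n)) ^ 2 + D)) Filter.atTop := by
        refine Filter.liminf_le_liminf (Filter.Eventually.of_forall fun k => ?_)
        rw [← ofReal_integral_eq_lintegral_ofReal (hu2 k)
          (Filter.Eventually.of_forall fun x => sq_nonneg _)]
        exact ENNReal.ofReal_le_ofReal (hk k)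
    _ = ENNReal.ofReal D := by
        refine Filter.Tendsto.liminf_eq ((ENNReal.continuous_ofReal.tendsto _).comp ?_)
        simpa using (hmean.pow 2).add_const D

/-- Composing with the dilation by `r = μ^{-1/2}` multiplies the squared gradient by `r² = 1/μ`,
which converts the constant `1` for `γ` into `μ`; smaller constants follow trivially. -/
lemma poincare_map_smul {μ lam : ℝ} (hμ : 0 < μ) (hle : lam ≤ μ) :
    Poincare lam ((γ n).map (fun x => (Real.sqrt μ)⁻¹ • x)) := by
  intro g hg hgi h0
  set r := (Real.sqrt μ)⁻¹ with hr
  have hr2 : μ * r ^ 2 = 1 := by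
    rw [hr, inv_pow, Real.sq_sqrt hμ.le, mul_inv_cancel₀ hμ.ne']
  have hrm : Measurable fun x : E n => r • x := by fun_prop
  have hgc : Continuous g := hg.continuous
  have hgdc : Continuous (gradient g) :=
    (LinearIsometryEquiv.continuous _).comp (hg.continuous_fderiv (by simp))
  rw [integral_map hrm.aemeasurable hgc.aestronglyMeasurable] at h0
  rw [integrable_map_measure hgc.aestronglyMeasurable hrm.aemeasurable] at hgi
  rw [lintegral_map (hgc.measurable.enorm.pow_const 2) hrm,
    lintegral_map (hgdc.measurable.enorm.pow_const 2) hrm]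
  have hfd : ∀ x, fderiv ℝ (fun x => g (r • x)) x = r • fderiv ℝ g (r • x) := fun x => by
    have h1 := ((hg.differentiable (by simp) (r • x)).hasFDerivAt).comp x
      ((hasFDerivAt_id (𝕜 := ℝ) x).const_smul r)
    have h2 : HasFDerivAt (fun x => g (r • x)) _ x := h1
    rw [h2.fderiv]
    ext v; simp
  have hP := gauss_poincare (g := fun x => g (r • x)) (hg.comp (by fun_prop)) hgi h0
  simp_rw [hfd] at hP
  calc ENNReal.ofReal lam * ∫⁻ x, ‖g (r • x)‖ₑ ^ 2 ∂(γ n)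
      ≤ ENNReal.ofReal μ * ∫⁻ x, ‖r • fderiv ℝ g (r • x)‖ₑ ^ 2 ∂(γ n) :=
        mul_le_mul' (ENNReal.ofReal_le_ofReal hle) hP
    _ = ∫⁻ x, ENNReal.ofReal μ * ‖r • fderiv ℝ g (r • x)‖ₑ ^ 2 ∂(γ n) := by
        rw [lintegral_const_mul' _ _ ENNReal.ofReal_ne_top]
    _ = ∫⁻ x, ‖gradient g (r • x)‖ₑ ^ 2 ∂(γ n) := by
        refine lintegral_congr fun x => ?_
        rw [← ofReal_norm, ← ofReal_norm, ← ENNReal.ofReal_pow (norm_nonneg _),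
          ← ENNReal.ofReal_pow (norm_nonneg _), ← ENNReal.ofReal_mul hμ.le, norm_gradient,
          norm_smul, mul_pow, ← mul_assoc, Real.norm_eq_abs, sq_abs, hr2, one_mul]

end gaussPoincare

/-! ### Isotropic Gaussian densities -/

section isotropic

variable {n : ℕ}

/-- The density with respect to `γ` of the centered Gaussian measure with covariance `μ⁻¹` times
the identity. -/
noncomputable def isoDensity (n : ℕ) (μ : ℝ) (x : E n) : ℝ :=
  μ ^ ((n : ℝ) / 2) * Real.exp ((1 - μ) * ‖x‖ ^ 2 / 2)

lemma isoDensity_pos {μ : ℝ} (hμ : 0 < μ) (x : E n) : 0 < isoDensity n μ x := by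
  unfold isoDensity; positivity

lemma contDiff_isoDensity (μ : ℝ) : ContDiff ℝ ∞ (isoDensity n μ) := by
  unfold isoDensity
  exact contDiff_const.mul (((contDiff_const.mul (contDiff_norm_sq ℝ)).div_const 2).exp)

lemma withGaussDensity_isoDensity {μ : ℝ} (hμ : 0 < μ) :
    withGaussDensity (isoDensity n μ) = (γ n).map (fun x => (Real.sqrt μ)⁻¹ • x) := by
  have hpi := Real.pi_pos
  rw [map_smul_gaussian n hμ, withGaussDensity, gamma_eq_withDensity,
    ← withDensity_mul _ (measurable_gaussDensity n 1).ennreal_ofReal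
      (contDiff_isoDensity μ).continuous.measurable.ennreal_ofReal]
  congr 1
  ext x
  simp only [Pi.mul_apply]
  rw [← ENNReal.ofReal_mul (gaussDensity_nonneg n one_pos x)]
  congr 1
  rw [gaussDensity, isoDensity, gaussDensity, div_eq_mul_one_div μ,
    Real.mul_rpow hμ.le (by positivity), mul_mul_mul_comm, ← Real.exp_add, mul_comm (μ ^ _)]
  congr 2
  ring

lemma integral_norm_sq_gamma : ∫ x : E n, ‖x‖ ^ 2 ∂(γ n) = n := by
  simp_rw [norm_sq_eq_sum]
  have h1 : ∀ i : Fin n, ∀ z : E n,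
      (inner ℝ (EuclideanSpace.single i (1 : ℝ)) z : ℝ) = z i := fun i z => by
    simp [EuclideanSpace.inner_single_left]
  have h2 : ∀ i : Fin n, ∫ z : E n, z i ^ 2 ∂(γ n) = 1 := fun i => by
    have := integral_inner_sq_gamma (EuclideanSpace.single i (1 : ℝ))
    simp_rw [h1] at this
    simpa using this
  rw [integral_finsetSum]
  · simp [h2]
  · intro i _
    have := (memLp_inner_gamma (EuclideanSpace.single i (1 : ℝ))).integrable_sq
    simp_rw [h1] at this
    exact this

lemma integrable_norm_sq_gamma : Integrable (fun x : E n => ‖x‖ ^ 2) (γ n) :=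
  (IsGaussian.memLp_two_id (μ := γ n)).integrable_norm_pow two_ne_zero

lemma integrable_norm_sq_iso {μ : ℝ} (hμ : 0 < μ) :
    Integrable (fun x : E n => ‖x‖ ^ 2) (withGaussDensity (isoDensity n μ)) := by
  rw [withGaussDensity_isoDensity hμ, integrable_map_measure (by fun_prop) (by fun_prop)]
  simp_rw [Function.comp_def, norm_smul, mul_pow]
  exact integrable_norm_sq_gamma.const_mul _

lemma integral_norm_sq_iso {μ : ℝ} (hμ : 0 < μ) :
    ∫ x : E n, ‖x‖ ^ 2 ∂(withGaussDensity (isoDensity n μ)) = n / μ := by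
  rw [withGaussDensity_isoDensity hμ, integral_map (by fun_prop) (by fun_prop)]
  simp_rw [norm_smul, mul_pow]
  rw [integral_const_mul, integral_norm_sq_gamma, Real.norm_eq_abs, sq_abs, inv_pow,
    Real.sq_sqrt hμ.le]
  ring

lemma isCenteredPoincareDensity_iso {μ lam : ℝ} (hμ : 0 < μ) (hle : lam ≤ μ) :
    IsCenteredPoincareDensity n lam (isoDensity n μ) where
  measurable := (contDiff_isoDensity μ).continuous.measurable
  nonneg x := (isoDensity_pos hμ x).le
  isProbabilityMeasure := by
    rw [withGaussDensity_isoDensity hμ]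
    exact Measure.isProbabilityMeasure_map (by fun_prop)
  centered := by
    rw [withGaussDensity_isoDensity hμ]
    have hi : Integrable (fun x : E n => x) (γ n) := IsGaussian.integrable_id
    constructor
    · rw [integrable_map_measure (by fun_prop) (by fun_prop)]
      exact hi.smul (Real.sqrt μ)⁻¹
    · rw [integral_map (by fun_prop) (by fun_prop), integral_smul, γ, integral_id_stdGaussian,
        smul_zero]
  poincare := by
    rw [withGaussDensity_isoDensity hμ]
    exact poincare_map_smul hμ hle

lemma pd_isoDensity (μ : ℝ) (i : Fin n) (x : E n) :
    pd i (isoDensity n μ) x = (1 - μ) * isoDensity n μ x * x i := by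
  have h1 : HasFDerivAt (fun x : E n => (1 - μ) * ‖x‖ ^ 2) _ x :=
    ((hasStrictFDerivAt_norm_sq x).hasFDerivAt).const_mul (1 - μ)
  have h2 : HasFDerivAt (fun x : E n => (1 - μ) * ‖x‖ ^ 2 * (2⁻¹ : ℝ)) _ x := h1.mul_const 2⁻¹
  have h3 : HasFDerivAt (isoDensity n μ) _ x := (h2.exp).const_mul (μ ^ ((n : ℝ) / 2))
  rw [pd, h3.fderiv]
  simp [isoDensity, div_eq_mul_inv, EuclideanSpace.inner_single_right]
  ring

lemma isWeakGradient_iso (μ : ℝ) : IsWeakGradient (isoDensity n μ)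
    (fun x => ((1 - μ) * isoDensity n μ x) • x) := by
  have hc : Continuous (isoDensity n μ) := (contDiff_isoDensity μ).continuous
  have hGc : Continuous fun x : E n => ((1 - μ) * isoDensity n μ x) • x := by fun_prop
  refine ⟨hc.locallyIntegrable, hGc.locallyIntegrable, fun φ hφ hcs => ?_⟩
  have hb := BddSmooth.of_hasCompactSupport hφ hcs
  have hgc : Continuous (gradient φ) :=
    (LinearIsometryEquiv.continuous _).comp (hφ.continuous_fderiv (by simp))
  have hgs : HasCompactSupport (gradient φ) :=
    (hcs.fderiv (𝕜 := ℝ)).comp_left (g := (InnerProductSpace.toDual ℝ (E n)).symm) (by simp)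
  have i1 : Integrable (fun x => isoDensity n μ x • gradient φ x) volume :=
    (hc.smul hgc).integrable_of_hasCompactSupport hgs.smul_left
  have i2 : Integrable (fun x => φ x • ((1 - μ) * isoDensity n μ x) • x) volume :=
    (hφ.continuous.smul hGc).integrable_of_hasCompactSupport hcs.smul_right
  ext i
  have e1 := (EuclideanSpace.proj (𝕜 := ℝ) i).integral_comp_comm i1
  have e2 := (EuclideanSpace.proj (𝕜 := ℝ) i).integral_comp_comm i2
  simp only [PiLp.proj_apply, PiLp.smul_apply, gradient_apply, smul_eq_mul] at e1 e2
  rw [PiLp.neg_apply, ← e1, ← e2]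
  have hpdc : Continuous (pd i φ) := (hb.pd i).continuous
  have hpds : HasCompactSupport (pd i φ) := hcs.fderiv_apply (𝕜 := ℝ) (EuclideanSpace.single i 1)
  have hpdi : ∀ x, fderiv ℝ (isoDensity n μ) x (EuclideanSpace.single i 1) =
    (1 - μ) * isoDensity n μ x * x i := pd_isoDensity μ i
  have := integral_mul_fderiv_eq_neg_fderiv_mul_of_integrable (μ := (volume : Measure (E n)))
    (f := isoDensity n μ) (g := φ) (v := EuclideanSpace.single i 1) ?_ ?_ ?_
    (fun x _ => (contDiff_isoDensity μ).differentiable (by simp) x)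
    (fun x _ => hb.differentiable x)
  · simp_rw [hpdi] at this
    refine Eq.trans this ?_
    congr 2; ext x; ring
  · simp_rw [hpdi]
    have hcoord : Continuous fun x : E n => x i := by fun_prop
    exact (((hc.const_mul _).mul hcoord).mul hb.continuous).integrable_of_hasCompactSupport
      hcs.mul_left
  · exact (hc.mul hpdc).integrable_of_hasCompactSupport hpds.mul_left
  · exact (hc.mul hb.continuous).integrable_of_hasCompactSupport hcs.mul_left

/-- The classical gradient is one competitor in the infimum. This upper bound suffices: both
sharpness and equality need only that the Fisher information is not too large. -/
lemma fisherInfo_iso_le {μ : ℝ} (hμ : 0 < μ) :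
    fisherInfo (isoDensity n μ) ≤ ENNReal.ofReal ((1 - μ) ^ 2 * (n / μ)) := by
  refine (iInf₂_le _ (isWeakGradient_iso μ)).trans (le_of_eq ?_)
  have hpos := fun x => isoDensity_pos (n := n) hμ x
  have hi := (integrable_withGaussDensity (contDiff_isoDensity μ).continuous.measurable
    (fun x => (hpos x).le) _).1 (integrable_norm_sq_iso (n := n) hμ)
  have h1 : ∀ x : E n, ‖((1 - μ) * isoDensity n μ x) • x‖ₑ ^ 2 / ENNReal.ofReal (isoDensity n μ x)
      = ENNReal.ofReal ((1 - μ) ^ 2 * (isoDensity n μ x * ‖x‖ ^ 2)) := by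
    intro x
    rw [← ofReal_norm, ← ENNReal.ofReal_pow (norm_nonneg _), ← ENNReal.ofReal_div_of_pos (hpos x),
      norm_smul, mul_pow, Real.norm_eq_abs, sq_abs]
    congr 1
    have := (hpos x).ne'
    field_simp
  simp_rw [h1]
  rw [← ofReal_integral_eq_lintegral_ofReal (hi.const_mul _) (Filter.Eventually.of_forall fun x =>
    mul_nonneg (sq_nonneg _) (mul_nonneg (hpos x).le (sq_nonneg _))), integral_const_mul,
    ← integral_withGaussDensity (contDiff_isoDensity μ).continuous.measurable
      (fun x => (hpos x).le), integral_norm_sq_iso hμ]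

lemma entropy_iso {μ : ℝ} (hμ : 0 < μ) :
    entropy (isoDensity n μ) = c μ / 2 * ((1 - μ) ^ 2 * (n / μ)) := by
  have hpos := fun x => isoDensity_pos (n := n) hμ x
  have hprob := (isCenteredPoincareDensity_iso (n := n) hμ le_rfl).isProbabilityMeasure
  rw [entropy, ← integral_withGaussDensity (contDiff_isoDensity μ).continuous.measurable
      (fun x => (hpos x).le)]
  have h1 : ∀ x : E n, Real.log (isoDensity n μ x) =
      (n : ℝ) / 2 * Real.log μ + (1 - μ) / 2 * ‖x‖ ^ 2 := fun x => by
    rw [isoDensity, Real.log_mul (by positivity) (by positivity), Real.log_rpow hμ, Real.log_exp]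
    ring
  simp_rw [h1]
  rw [integral_add (integrable_const _) ((integrable_norm_sq_iso hμ).const_mul _),
    integral_const_mul ((1 - μ) / 2), integral_norm_sq_iso hμ]
  simp only [integral_const, probReal_univ, smul_eq_mul, one_mul]
  unfold c
  split_ifs with h
  · simp [h]
  · have : 1 - μ ≠ 0 := sub_ne_zero.2 (Ne.symm h)
    field_simp
    ring

lemma lineGaussDensity_eq (lam : ℝ) : lineGaussDensity lam = isoDensity 1 lam := by
  ext x
  rw [lineGaussDensity, isoDensity, Real.sqrt_eq_rpow, norm_sq_eq_sum]
  simp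

/-- Tests the inequality on the isotropic Gaussian of parameter `μ`. The conditions `n ≥ 1` and `μ ≠
1` make its entropy positive, so that the ratio carries information. -/
lemma c_le_of_entropy_le {lam C μ : ℝ} (hn : 1 ≤ n) (hμ : 0 < μ) (hle : lam ≤ μ) (h1 : μ ≠ 1)
    (hC : ∀ f : E n → ℝ, IsCenteredPoincareDensity n lam f → fisherInfo f ≠ ⊤ →
      entropy f ≤ C / 2 * (fisherInfo f).toReal) : c μ ≤ C := by
  have hn' : (0 : ℝ) < n := by exact_mod_cast hn
  have hI := fisherInfo_iso_le (n := n) hμ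
  have hpos : 0 < (1 - μ) ^ 2 * ((n : ℝ) / μ) := by
    have := sub_ne_zero.2 (Ne.symm h1); positivity
  have h := hC _ (isCenteredPoincareDensity_iso hμ hle) (hI.trans_lt ENNReal.ofReal_lt_top).ne
  have hIr := ENNReal.toReal_le_of_le_ofReal hpos.le hI
  have hc := c_pos hμ
  rw [entropy_iso hμ] at h
  by_contra hcon
  push Not at hcon
  -- The upper bound on Fisher information is usable only when `C ≥ 0`; for `C ≤ 0` positivity of
  -- the entropy is already contradictory.
  rcases le_total 0 C with h0 | h0
  · have h3 := mul_le_mul_of_nonneg_left hIr (by positivity : 0 ≤ C / 2)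
    have h4 := mul_lt_mul_of_pos_right (by linarith : C / 2 < c μ / 2) hpos
    linarith
  · have h2 : C / 2 * (fisherInfo (isoDensity n μ)).toReal ≤ 0 :=
      mul_nonpos_of_nonpos_of_nonneg (by linarith) ENNReal.toReal_nonneg
    have h3 := mul_pos (half_pos hc) hpos
    linarith

/-- Equivalent to `log(1+ε) ≥ 2ε/(2+ε)`. It replaces continuity of `c` at `1` in the sharpness
argument. -/
lemma inv_le_c_one_add {ε : ℝ} (hε : 0 < ε) : 1 / (2 + ε) ≤ c (1 + ε) := by
  have h := Real.le_log_one_add_of_nonneg hε.le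
  rw [c, if_neg (by linarith), div_le_div_iff₀ (by positivity) (by
    have : (1 - (1 + ε)) ^ 2 = ε ^ 2 := by ring
    rw [this]; positivity)]
  rw [div_le_iff₀ (by positivity)] at h
  nlinarith [mul_le_mul_of_nonneg_left h (by positivity : 0 ≤ 1 + ε)]

end isotropic

end GaussLSI

/-! ### The improved inequality, sharpness and the equality case -/

theorem theorem1 (n : ℕ) (lam : ℝ) (hlam : 0 < lam) :
    GaussLSI.c lam < 1 ∧
    -- the improved inequality, and its form as a lower bound on the deficit
    (∀ f : GaussLSI.E n → ℝ, GaussLSI.IsCenteredPoincareDensity n lam f →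
      GaussLSI.fisherInfo f ≠ ⊤ →
        Integrable (fun x => f x * Real.log (f x)) (GaussLSI.γ n) ∧
        GaussLSI.entropy f ≤ GaussLSI.c lam / 2 * (GaussLSI.fisherInfo f).toReal ∧
        GaussLSI.c₁ lam * (GaussLSI.fisherInfo f).toReal ≤ GaussLSI.deficit f) ∧
    -- no smaller constant is possible
    (1 ≤ n → ∀ C : ℝ,
      (∀ f : GaussLSI.E n → ℝ, GaussLSI.IsCenteredPoincareDensity n lam f →
        GaussLSI.fisherInfo f ≠ ⊤ →
          GaussLSI.entropy f ≤ C / 2 * (GaussLSI.fisherInfo f).toReal) →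
      GaussLSI.c lam ≤ C) ∧
    -- equality holds for a Gaussian density on the line
    (GaussLSI.IsCenteredPoincareDensity 1 lam (GaussLSI.lineGaussDensity lam) ∧
      GaussLSI.fisherInfo (GaussLSI.lineGaussDensity lam) ≠ ⊤ ∧
      GaussLSI.entropy (GaussLSI.lineGaussDensity lam) =
        GaussLSI.c lam / 2 *
          (GaussLSI.fisherInfo (GaussLSI.lineGaussDensity lam)).toReal) := by
  refine ⟨GaussLSI.c_lt_one hlam, fun f hf hI => ?_, fun hn C hC => ?_, ?_⟩
  · obtain ⟨h1, h2⟩ := GaussLSI.entropy_le hlam hf hI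
    refine ⟨h1, h2, ?_⟩
    rw [GaussLSI.c₁, GaussLSI.deficit]
    linarith
  -- For `λ = 1` the candidate extremal is `γ` itself, which only gives `0 ≤ 0`. The parameters `μ =
  -- 1 + ε` remain admissible and give the constant as `ε → 0`.
  · by_cases h1 : lam = 1
    · subst h1
      have hε : ∀ ε : ℝ, 0 < ε → 1 / (2 + ε) ≤ C := fun ε hε =>
        (GaussLSI.inv_le_c_one_add hε).trans
          (GaussLSI.c_le_of_entropy_le hn (by linarith) (by linarith) (by linarith) hC)
      have hc1 : GaussLSI.c 1 = 1 / 2 := by simp [GaussLSI.c]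
      have ht : Filter.Tendsto (fun ε : ℝ => 1 / (2 + ε)) (nhdsWithin 0 (Set.Ioi 0))
          (nhds (1 / (2 + 0))) := by
        refine tendsto_nhdsWithin_of_tendsto_nhds (ContinuousAt.tendsto ?_)
        exact continuousAt_const.div (by fun_prop) (by norm_num)
      rw [hc1, ← add_zero (2 : ℝ)]
      exact le_of_tendsto ht (Filter.eventually_of_mem self_mem_nhdsWithin hε)
    · exact GaussLSI.c_le_of_entropy_le hn hlam le_rfl h1 hC
  · rw [GaussLSI.lineGaussDensity_eq]
    have hd := GaussLSI.isCenteredPoincareDensity_iso (n := 1) hlam le_rfl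
    have hle := GaussLSI.fisherInfo_iso_le (n := 1) hlam
    have hne := (hle.trans_lt ENNReal.ofReal_lt_top).ne
    -- The theorem itself supplies one inequality, and the upper bound on Fisher information the
    -- other.
    refine ⟨hd, hne, le_antisymm (GaussLSI.entropy_le hlam hd hne).2 ?_⟩
    rw [GaussLSI.entropy_iso hlam]
    exact mul_le_mul_of_nonneg_left (ENNReal.toReal_le_of_le_ofReal (by positivity) hle)
      (half_pos (GaussLSI.c_pos hlam)).le
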